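/- Let $k$ be a field of any characteristic. For $i=1,2$ let $d_i,e_i\ge 1$ be integers, let $P_i(X,Z)\in k[X,Z]$ be monic in $Z$ with $r_i=\deg_Z P_i$, let $Q_i(X,Y,Z)\in k[X,Y,Z]$ be monic in $Y$ with $s_i=\deg_Y Q_i$, and put $$B_i=\frac{k[X,Y,Z,T]}{(X^{d_i}Y-P_i(X,Z),\;X^{e_i}T-Q_i(X,Y,Z))},$$ with $x_i,y_i,z_i,t_i$ the images of $X,Y,Z,T$ in $B_i$. Assume that for $i=1,2$ one of the following holds: $r_i\ge2$ and $s_i\ge2$; or $r_i\ge 2$ and $s_i=1$; or $r_i=1$, $s_i\ge2$ and $e_i\ge2$. Let $\psi:B_2\to B_1$ be a $k$-algebra isomorphism, and suppose $r_1,r_2>1$. Then: (I) $(r_1,s_1)=(r_2,s_2)=:(r,s)$, and there exist $\lambda,\gamma\in k^*$ and $\delta(X)\in k[X]$ such that $\psi(x_2)=\lambda x_1$ and $\psi(z_2)=\gamma z_1+\delta(x_1)$. (II) If $s>1$, then $(d_1,e_1)=(d_2,e_2)=:(d,e)$, and, for these $\lambda,\gamma,\delta$, there exists $f(X,Z)\in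 k[X,Z]$ with $\deg_Z f<r$ such that (i) $\psi(y_2)=\nu y_1+g(x_1,z_1)$, where $\nu=\lambda^{-d}\gamma^r$ and $g=\lambda^{-d}f$; (ii) $P_2(\lambda X,\gamma Z+\delta(X))=\gamma^rP_1(X,Z)+X^df(X,Z)$; in particular $P_2(0,\gamma Z+\delta(0))=\gamma^rP_1(0,Z)$. Moreover, setting $X_2=\lambda X$, $Y_2=\nu Y+g(X,Z)$, $Z_2=\gamma Z+\delta(X)$ and $G=P_1(X,Z)-X^dY$, one has (a) $k[X,Y,Z]=k[X_2,Y_2,Z_2]$; (b) $P_2(X_2,Z_2)-X_2^dY_2=\gamma^rG$; (c) $(Q_2(X_2,Y_2,Z_2),\,P_2(X_2,Z_2)-X_2^dY_2,\,X_2^e)=(Q_1(X,Y,Z),\,G,\,X^e)$ as ideals of $k[X,Y,Z]$; and in particular $Q_2(0,\nu Y+g(0,Z),\gamma Z+\delta(0))=\nu^sQ_1(0,Y,Z)+h(Y,Z)P_1(0,Z)$ for some $h\in k[Y,Z]$ with $\deg_Yh<s$. Conversely, suppose $(r_1,s_1)=(r_2,s_2)=:(r,s)$ with $s>1$, $(d_1,e_1)=(d_2,e_2)=:(d,e)$,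 and there are $\lambda,\gamma\in k^*$, $\delta\in k[X]$ and $f\in k[X,Z]$ with $\deg_Zf<r$ such that the identity $P_2(\lambda X,\gamma Z+\delta(X))=\gamma^rP_1(X,Z)+X^df(X,Z)$ and the equality of ideals (c) hold, where $\nu=\lambda^{-d}\gamma^r$, $g=\lambda^{-d}f$ and $X_2,Y_2,Z_2,G$ are defined as above. Then $B_1\cong B_2$ as $k$-algebras. -/

import Mathlib

/-- The value `p(x, z)` in a `k`-algebra of a polynomial `p(X, Z)`. The polynomial ring `k[X, Z]` is
represented as `k[X][Z]`, so that "monic in `Z`" and "degree in `Z`" are `Polynomial.Monic` and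
`Polynomial.degree`. -/
noncomputable def evalXZ {k A : Type*} [CommRing k] [CommRing A] [Algebra k A] (x z : A)
    (p : Polynomial (Polynomial k)) : A :=
  p.eval₂ (Polynomial.aeval (R := k) x).toRingHom z

/-- The value `q(x, y, z)` in a `k`-algebra of a polynomial `q(X, Y, Z)`. The polynomial ring
`k[X, Y, Z]`, where degrees in `Y` matter, is represented as `k[X][Z][Y]`: the inner variable is `X`,
the middle one is `Z` and the outer one is `Y`. -/
noncomputable def evalXYZ {k A : Type*} [CommRing k] [CommRing A] [Algebra k A] (x y z : A)
    (q : Polynomial (Polynomial (Polynomial k))) : A :=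
  q.eval₂ (Polynomial.eval₂RingHom (Polynomial.aeval (R := k) x).toRingHom z) y

/-- The data `(d, e, P, Q)` defining a double Danielewski surface: positive integers `d`, `e`, a
polynomial `P(X, Z)` monic in `Z` and a polynomial `Q(X, Y, Z)` monic in `Y`. -/
structure DoubleDanielewski (k : Type*) [Field k] where
  d : ℕ
  e : ℕ
  P : Polynomial (Polynomial k)
  Q : Polynomial (Polynomial (Polynomial k))
  d_pos : 0 < d
  e_pos : 0 < e
  P_monic : P.Monic
  Q_monic : Q.Monic

namespace DoubleDanielewski

variable {k : Type*} [Field k] (S : DoubleDanielewski k)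

/-- `r`, the degree of `P` in `Z`. -/
noncomputable def r : ℕ := S.P.natDegree

/-- `s`, the degree of `Q` in `Y`. -/
noncomputable def s : ℕ := S.Q.natDegree

/-- The condition on `r`, `s`, `e` under which the Makar-Limanov invariant is `k[x]`. -/
def MLCondition : Prop :=
  (2 ≤ S.r ∧ 2 ≤ S.s) ∨ (2 ≤ S.r ∧ S.s = 1) ∨ (S.r = 1 ∧ 2 ≤ S.s ∧ 2 ≤ S.e)

/-- The ideal `(X^d Y - P(X, Z), X^e T - Q(X, Y, Z))` of `k[X, Y, Z, T]`; the variables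
`X`, `Y`, `Z`, `T` are numbered `0`, `1`, `2`, `3`. -/
noncomputable def relIdeal : Ideal (MvPolynomial (Fin 4) k) :=
  Ideal.span
    {MvPolynomial.X 0 ^ S.d * MvPolynomial.X 1 - evalXZ (MvPolynomial.X 0) (MvPolynomial.X 2) S.P,
     MvPolynomial.X 0 ^ S.e * MvPolynomial.X 3 -
      evalXYZ (MvPolynomial.X 0) (MvPolynomial.X 1) (MvPolynomial.X 2) S.Q}

/-- The coordinate ring `B = k[X, Y, Z, T] / (X^d Y - P(X, Z), X^e T - Q(X, Y, Z))`. -/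
abbrev B : Type _ := MvPolynomial (Fin 4) k ⧸ S.relIdeal

/-- The image of `X` in `B`. -/
noncomputable def x : S.B := Ideal.Quotient.mk S.relIdeal (MvPolynomial.X 0)

/-- The image of `Y` in `B`. -/
noncomputable def y : S.B := Ideal.Quotient.mk S.relIdeal (MvPolynomial.X 1)

/-- The image of `Z` in `B`. -/
noncomputable def z : S.B := Ideal.Quotient.mk S.relIdeal (MvPolynomial.X 2)

/-- `P(a, c) - a^d b`. -/
noncomputable def polyG {A : Type*} [CommRing A] [Algebra k A] (a b c : A) : A :=
  evalXZ a c S.P - a ^ S.d * b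

/-- The ideal `(Q(a, b, c), P(a, c) - a^d b, a^e)`. -/
noncomputable def tripleIdeal {A : Type*} [CommRing A] [Algebra k A] (a b c : A) : Ideal A :=
  Ideal.span {evalXYZ a b c S.Q, S.polyG a b c, a ^ S.e}

end DoubleDanielewski

namespace NewCoord

variable {k : Type*} [Field k]

/-- `X₂ = lam X` in `k[X, Y, Z]`, whose variables `X`, `Y`, `Z` are numbered `0`, `1`, `2`. -/
noncomputable def X₂ (lam : k) : MvPolynomial (Fin 3) k := lam • MvPolynomial.X 0

/-- `Y₂ = nu Y + g(X, Z)` in `k[X, Y, Z]`. -/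
noncomputable def Y₂ (nu : k) (g : Polynomial (Polynomial k)) : MvPolynomial (Fin 3) k :=
  nu • MvPolynomial.X 1 + evalXZ (MvPolynomial.X 0) (MvPolynomial.X 2) g

/-- `Z₂ = gam Z + delta(X)` in `k[X, Y, Z]`. -/
noncomputable def Z₂ (gam : k) (delta : Polynomial k) : MvPolynomial (Fin 3) k :=
  gam • MvPolynomial.X 2 + Polynomial.aeval (MvPolynomial.X 0) delta

end NewCoord

/-!
With exponents in `ℚ ×ₗ ℚ`, `B` embeds into a field of Hahn series so that `x`, `z` have orders
`(0, 1)`, `(-1, 0)` and the monomials of degree less than `r` in `z` and less than `s` in `y` have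
pairwise distinct orders. The order of a sum is then governed by single monomials, which replaces
the filtrations and homogenized exponential maps of the classical proof: the leading terms of a
nontrivial exponential map form a multiplicative family, and, as `r ≥ 2`, this forces its invariants
to be polynomials in `x`. Since such a map exists, an isomorphism sends `x` to a polynomial in `x`,
of degree one by symmetry, and without constant term because the fibres `x = c`, `c ≠ 0`, are affine
lines while the fibre `x = 0` is not. It then sends `z` to a linear polynomial in `z` over `k[x]`,
the pole orders along `x` give back `r`, `s`, `d`, `e`, and the relation `x ^ d * y = P(x, z)`
yields the image of `y`. Finally the ideal `(Q, G, X ^ e)` is the kernel of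
`k[X, Y, Z] → B / (x ^ e)`, so that it corresponds under isomorphisms, and it determines `B`.
-/

section

open Polynomial

/-! ### Evaluation and points -/

section Evaluation

variable {k A A' : Type*} [CommRing k] [CommRing A] [CommRing A'] [Algebra k A'] [Algebra k A]

/-- `evalXZ x z` as a homomorphism of `k`-algebras. -/
noncomputable def evalXZHom (x z : A) : k[X][X] →ₐ[k] A :=
  eval₂AlgHom (aeval x) z fun _ => Commute.all _ _

theorem evalXZHom_apply (x z : A) (p : k[X][X]) : evalXZHom x z p = evalXZ x z p := rfl

@[simp] theorem evalXZ_C (x z : A) (p : k[X]) : evalXZ x z (C p) = aeval x p := by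
  simp [evalXZ]

@[simp] theorem evalXZ_X (x z : A) : evalXZ (k := k) x z X = z := by
  simp [evalXZ]

@[simp] theorem evalXZ_add (x z : A) (p q : k[X][X]) :
    evalXZ x z (p + q) = evalXZ x z p + evalXZ x z q := map_add (evalXZHom x z) p q

@[simp] theorem evalXZ_sub (x z : A) (p q : k[X][X]) :
    evalXZ x z (p - q) = evalXZ x z p - evalXZ x z q := map_sub (evalXZHom x z) p q

@[simp] theorem evalXZ_mul (x z : A) (p q : k[X][X]) :
    evalXZ x z (p * q) = evalXZ x z p * evalXZ x z q := map_mul (evalXZHom x z) p q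

@[simp] theorem evalXZ_pow (x z : A) (p : k[X][X]) (n : ℕ) :
    evalXZ x z (p ^ n) = evalXZ x z p ^ n := map_pow (evalXZHom x z) p n

@[simp] theorem evalXZ_smul (x z : A) (c : k) (p : k[X][X]) :
    evalXZ x z (c • p) = c • evalXZ x z p := map_smul (evalXZHom x z) c p

theorem evalXZ_eq_sum (x z : A) (p : k[X][X]) :
    evalXZ x z p = ∑ i ∈ Finset.range (p.natDegree + 1), aeval x (p.coeff i) * z ^ i :=
  eval₂_eq_sum_range _ _

theorem evalXZ_monic {p : k[X][X]} (hp : p.Monic) (x z : A) :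
    evalXZ x z p =
      z ^ p.natDegree + ∑ i ∈ Finset.range p.natDegree, aeval x (p.coeff i) * z ^ i := by
  rw [evalXZ_eq_sum, Finset.sum_range_succ, hp.coeff_natDegree, map_one, one_mul, add_comm]

/-- `evalXYZ x y z` as a homomorphism of `k`-algebras. -/
noncomputable def evalXYZHom (x y z : A) : k[X][X][X] →ₐ[k] A :=
  eval₂AlgHom (evalXZHom x z) y fun _ => Commute.all _ _

@[simp] theorem evalXYZ_C (x y z : A) (p : k[X][X]) : evalXYZ x y z (C p) = evalXZ x z p :=
  eval₂_C _ _

@[simp] theorem evalXYZ_X (x y z : A) : evalXYZ (k := k) x y z X = y :=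
  eval₂_X _ _

@[simp] theorem evalXYZ_zero (x y z : A) : evalXYZ (k := k) x y z 0 = 0 :=
  map_zero (evalXYZHom x y z)

@[simp] theorem evalXYZ_add (x y z : A) (p q : k[X][X][X]) :
    evalXYZ x y z (p + q) = evalXYZ x y z p + evalXYZ x y z q := map_add (evalXYZHom x y z) p q

@[simp] theorem evalXYZ_sub (x y z : A) (p q : k[X][X][X]) :
    evalXYZ x y z (p - q) = evalXYZ x y z p - evalXYZ x y z q := map_sub (evalXYZHom x y z) p q

@[simp] theorem evalXYZ_mul (x y z : A) (p q : k[X][X][X]) :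
    evalXYZ x y z (p * q) = evalXYZ x y z p * evalXYZ x y z q := map_mul (evalXYZHom x y z) p q

@[simp] theorem evalXYZ_pow (x y z : A) (p : k[X][X][X]) (n : ℕ) :
    evalXYZ x y z (p ^ n) = evalXYZ x y z p ^ n := map_pow (evalXYZHom x y z) p n

theorem evalXYZ_eq_sum (x y z : A) (q : k[X][X][X]) :
    evalXYZ x y z q = ∑ j ∈ Finset.range (q.natDegree + 1), evalXZ x z (q.coeff j) * y ^ j :=
  eval₂_eq_sum_range _ _

theorem algHom_evalXZ (f : A →ₐ[k] A') (x z : A) (p : k[X][X]) :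
    f (evalXZ x z p) = evalXZ (f x) (f z) p := by
  simp only [evalXZ_eq_sum, map_sum, map_mul, map_pow, aeval_algHom_apply]

theorem algHom_evalXYZ (f : A →ₐ[k] A') (x y z : A) (q : k[X][X][X]) :
    f (evalXYZ x y z q) = evalXYZ (f x) (f y) (f z) q := by
  simp only [evalXYZ_eq_sum, map_sum, map_mul, map_pow, algHom_evalXZ]

theorem aeval_mem_subalgebra (T : Subalgebra k A) {x : A} (hx : x ∈ T) (p : k[X]) :
    aeval x p ∈ T :=
  Algebra.adjoin_le (Set.singleton_subset_iff.2 hx) (aeval_mem_adjoin_singleton k x)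

theorem evalXZ_mem_subalgebra (T : Subalgebra k A) {x z : A} (hx : x ∈ T) (hz : z ∈ T)
    (p : k[X][X]) : evalXZ x z p ∈ T := by
  rw [evalXZ_eq_sum]
  exact sum_mem fun i _ => mul_mem (aeval_mem_subalgebra T hx _) (pow_mem hz i)

theorem evalXYZ_mem_subalgebra (T : Subalgebra k A) {x y z : A} (hx : x ∈ T) (hy : y ∈ T)
    (hz : z ∈ T) (q : k[X][X][X]) : evalXYZ x y z q ∈ T := by
  rw [evalXYZ_eq_sum]
  exact sum_mem fun j _ => mul_mem (evalXZ_mem_subalgebra T hx hz _) (pow_mem hy j)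

end Evaluation

section Multipliers

variable {k A : Type*} [CommRing k] [CommRing A] [Algebra k A]

/-- The subalgebra of those elements of `A` that multiply the submodule `N` into itself. -/
def multiplierSubalgebra (N : Submodule k A) : Subalgebra k A where
  carrier := {a | ∀ n ∈ N, a * n ∈ N}
  mul_mem' ha hb n hn := by rw [mul_assoc]; exact ha _ (hb _ hn)
  add_mem' ha hb n hn := by rw [add_mul]; exact N.add_mem (ha _ hn) (hb _ hn)
  algebraMap_mem' c n hn := by rw [← Algebra.smul_def]; exact N.smul_mem _ hn

theorem mem_multiplierSubalgebra_span {s : Set A} {a : A}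
    (h : ∀ b ∈ s, a * b ∈ Submodule.span k s) :
    a ∈ multiplierSubalgebra (Submodule.span k s) := by
  have hle : Submodule.span k s ≤ (Submodule.span k s).comap (LinearMap.mulLeft k a) :=
    Submodule.span_le.2 h
  exact hle

theorem adjoin_le_of_le_multiplierSubalgebra {N : Submodule k A} {s : Set A} (h1 : (1 : A) ∈ N)
    (hs : s ⊆ multiplierSubalgebra N) : Subalgebra.toSubmodule (Algebra.adjoin k s) ≤ N := by
  intro a ha
  simpa using Algebra.adjoin_le (S := multiplierSubalgebra N) hs ha 1 h1

end Multipliers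

namespace DoubleDanielewski

variable {k : Type*} [Field k] (S : DoubleDanielewski k)

/-- The class of `T` in the coordinate ring `S.B`. -/
noncomputable def t : S.B := Ideal.Quotient.mk S.relIdeal (MvPolynomial.X 3)

/-- `S.IsPoint x y z t` says that `(x, y, z, t)` is a point of the surface with values in the
algebra `A`. -/
structure IsPoint {A : Type*} [CommRing A] [Algebra k A] (x y z t : A) : Prop where
  pow_d_mul : x ^ S.d * y = evalXZ x z S.P
  pow_e_mul : x ^ S.e * t = evalXYZ x y z S.Q

theorem isPoint : S.IsPoint S.x S.y S.z S.t where
  pow_d_mul := by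
    rw [x, y, z, ← sub_eq_zero, ← Ideal.Quotient.mkₐ_eq_mk k, ← algHom_evalXZ, ← map_pow, ← map_mul,
      ← map_sub, Ideal.Quotient.mkₐ_eq_mk, Ideal.Quotient.eq_zero_iff_mem]
    exact Ideal.subset_span (Set.mem_insert _ _)
  pow_e_mul := by
    rw [x, y, z, t, ← sub_eq_zero, ← Ideal.Quotient.mkₐ_eq_mk k, ← algHom_evalXYZ, ← map_pow,
      ← map_mul, ← map_sub, Ideal.Quotient.mkₐ_eq_mk, Ideal.Quotient.eq_zero_iff_mem]
    exact Ideal.subset_span (Set.mem_insert_of_mem _ rfl)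

theorem adjoin_generators_eq_top : Algebra.adjoin k {S.x, S.y, S.z, S.t} = ⊤ := by
  have h : ({S.x, S.y, S.z, S.t} : Set S.B) =
      Ideal.Quotient.mkₐ k S.relIdeal '' Set.range MvPolynomial.X := by
    ext a
    simp only [Set.mem_insert_iff, Set.mem_singleton_iff, Set.mem_image, Set.mem_range,
      Fin.exists_fin_succ, x, y, z, t]
    simp [eq_comm]
  rw [h, ← AlgHom.map_adjoin, MvPolynomial.adjoin_range_X, Algebra.map_top,
    AlgHom.range_eq_top]
  exact Ideal.Quotient.mkₐ_surjective k S.relIdeal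

variable {S} {A : Type*} [CommRing A] [Algebra k A] {x y z t : A}

theorem IsPoint.map {A' : Type*} [CommRing A'] [Algebra k A'] (h : S.IsPoint x y z t)
    (f : A →ₐ[k] A') : S.IsPoint (f x) (f y) (f z) (f t) where
  pow_d_mul := by rw [← map_pow, ← map_mul, h.pow_d_mul, algHom_evalXZ]
  pow_e_mul := by rw [← map_pow, ← map_mul, h.pow_e_mul, algHom_evalXYZ]

/-- The homomorphism from the coordinate ring given by a point. -/
noncomputable def IsPoint.lift (h : S.IsPoint x y z t) : S.B →ₐ[k] A :=
  Ideal.Quotient.liftₐ S.relIdeal (MvPolynomial.aeval ![x, y, z, t]) fun a ha => by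
    have hle : S.relIdeal ≤ RingHom.ker (MvPolynomial.aeval (R := k) ![x, y, z, t]) := by
      rw [relIdeal, Ideal.span_le]
      rintro _ (rfl | rfl)
      · simp [algHom_evalXZ, h.pow_d_mul]
      · simp [algHom_evalXYZ, h.pow_e_mul]
    exact hle ha

@[simp] theorem IsPoint.lift_x (h : S.IsPoint x y z t) : h.lift S.x = x :=
  MvPolynomial.aeval_X _ _

@[simp] theorem IsPoint.lift_y (h : S.IsPoint x y z t) : h.lift S.y = y :=
  MvPolynomial.aeval_X _ _

@[simp] theorem IsPoint.lift_z (h : S.IsPoint x y z t) : h.lift S.z = z :=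
  MvPolynomial.aeval_X _ _

end DoubleDanielewski

/-! ### The spanning set of strip monomials -/

theorem exists_eq_add_C_mul {R : Type*} [CommRing R] (P : R[X]) (q : R[X][X]) :
    ∃ w a : R[X][X], q = w + C P * a ∧ w.degree ≤ q.degree ∧
      ∀ j, w.coeff j = q.coeff j %ₘ P := by
  let w : R[X][X] := ∑ j ∈ q.support, monomial j (q.coeff j %ₘ P)
  have hw : ∀ j, w.coeff j = q.coeff j %ₘ P := by
    intro j
    rw [finsetSum_coeff]
    by_cases hj : j ∈ q.support
    · rw [Finset.sum_eq_single_of_mem j hj fun i _ hi => coeff_monomial_of_ne _ hi.symm,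
        coeff_monomial_same]
    · rw [Finset.sum_eq_zero fun i hi => coeff_monomial_of_ne _ (ne_of_mem_of_not_mem hi hj).symm,
        notMem_support_iff.1 hj, zero_modByMonic]
  have hdvd : C P ∣ q - w := C_dvd_iff_dvd_coeff _ _ |>.2 fun j => by
    rw [coeff_sub, hw, sub_eq_of_eq_add' (modByMonic_add_div (q.coeff j) P).symm]
    exact dvd_mul_right _ _
  obtain ⟨a, ha⟩ := hdvd
  refine ⟨w, a, by rw [← ha]; ring, degree_le_iff_coeff_zero _ _ |>.2 fun j hj => ?_, hw⟩
  rw [hw, coeff_eq_zero_of_degree_lt hj, zero_modByMonic]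

namespace DoubleDanielewski

variable {k : Type*} [Field k] {S : DoubleDanielewski k}

variable (S) in
/-- `S.IsReduced w` says that `w` has degree less than `s` in `Y` and less than `r` in `Z`. -/
def IsReduced (w : k[X][X][X]) : Prop :=
  w.degree < S.s ∧ ∀ j, (w.coeff j).degree < S.r

theorem IsReduced.add {w w' : k[X][X][X]} (h : S.IsReduced w) (h' : S.IsReduced w') :
    S.IsReduced (w + w') :=
  ⟨(degree_add_le _ _).trans_lt (max_lt h.1 h'.1), fun j => by
    rw [coeff_add]
    exact (degree_add_le _ _).trans_lt (max_lt (h.2 j) (h'.2 j))⟩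

theorem IsReduced.C_C_mul {w : k[X][X][X]} (h : S.IsReduced w) (p : k[X]) :
    S.IsReduced (C (C p) * w) :=
  ⟨by rw [← smul_eq_C_mul]; exact (degree_smul_le _ _).trans_lt h.1, fun j => by
    rw [coeff_C_mul, ← smul_eq_C_mul]
    exact (degree_smul_le _ _).trans_lt (h.2 j)⟩

theorem exists_isReduced_add_C_P_mul {q : k[X][X][X]} (hq : q.degree < S.s) :
    ∃ w a, S.IsReduced w ∧ q = w + C S.P * a := by
  obtain ⟨w, a, hqw, hdeg, hcoeff⟩ := exists_eq_add_C_mul S.P q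
  refine ⟨w, a, ⟨hdeg.trans_lt hq, fun j => ?_⟩, hqw⟩
  rw [hcoeff, r, ← degree_eq_natDegree S.P_monic.ne_zero]
  exact degree_modByMonic_lt _ S.P_monic

theorem exists_isReduced_add_C_P_mul_add_Q_mul (q : k[X][X][X]) :
    ∃ w a b, S.IsReduced w ∧ q = w + C S.P * a + S.Q * b := by
  have hdeg : (q %ₘ S.Q).degree < S.s := by
    rw [s, ← degree_eq_natDegree S.Q_monic.ne_zero]
    exact degree_modByMonic_lt _ S.Q_monic
  obtain ⟨w, a, hw, hq⟩ := exists_isReduced_add_C_P_mul hdeg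
  exact ⟨w, a, q /ₘ S.Q, hw, by rw [← hq, modByMonic_add_div]⟩

theorem degree_Q_sub_X_pow_lt : (S.Q - X ^ S.s).degree < (S.s : WithBot ℕ) := by
  rw [s, ← degree_eq_natDegree S.Q_monic.ne_zero]
  exact degree_sub_lt_left (by rw [degree_X_pow, degree_eq_natDegree S.Q_monic.ne_zero])
    S.Q_monic.ne_zero (by rw [S.Q_monic.leadingCoeff, leadingCoeff_X_pow])

variable {A : Type*} [CommRing A] [Algebra k A] {x y z t : A}

/- Dividing the remainder `c` by `P` and `Q`: the multiple of `P` becomes a multiple of `x`, and the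
multiple of `Q` is absorbed by the factor `1 + x * a`. -/
theorem exists_mul_evalXYZ_Q_eq (h : x ^ S.d * y = evalXZ x z S.P) (n : ℕ) :
    ∃ a w c : k[X][X][X], S.IsReduced w ∧ (1 + x * evalXYZ x y z a) * evalXYZ x y z S.Q =
      y ^ S.s + evalXYZ x y z w + x ^ (n + 1) * evalXYZ x y z c := by
  obtain ⟨m, hm⟩ : ∃ m, S.d = m + 1 := ⟨S.d - 1, by have := S.d_pos; omega⟩
  have hP : evalXZ x z S.P = x * (x ^ m * y) := by rw [← h, hm]; ring
  have hCX : evalXYZ x y z (C (C (X : k[X]))) = x := by simp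
  induction n with
  | zero =>
    obtain ⟨w, a, hw, hQ⟩ := exists_isReduced_add_C_P_mul (degree_Q_sub_X_pow_lt (S := S))
    have hQ' := congr_arg (evalXYZ x y z) (sub_eq_iff_eq_add.1 hQ)
    simp only [evalXYZ_add, evalXYZ_mul, evalXYZ_pow, evalXYZ_C, evalXYZ_X, hP] at hQ'
    refine ⟨0, w, C (C X) ^ m * X * a, hw, ?_⟩
    simp only [evalXYZ_zero, evalXYZ_mul, evalXYZ_pow, hCX, evalXYZ_X]
    linear_combination hQ'
  | succ n ih =>
    obtain ⟨a, w, c, hw, hawc⟩ := ih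
    obtain ⟨w', a', b, hw', hc⟩ := exists_isReduced_add_C_P_mul_add_Q_mul (S := S) c
    have hc' := congr_arg (evalXYZ x y z) hc
    simp only [evalXYZ_add, evalXYZ_mul, evalXYZ_C, hP] at hc'
    refine ⟨a - C (C X) ^ n * b, w + C (C (X ^ (n + 1))) * w', C (C X) ^ m * X * a',
      hw.add (hw'.C_C_mul _), ?_⟩
    simp only [evalXYZ_add, evalXYZ_sub, evalXYZ_mul, evalXYZ_pow, hCX, evalXYZ_X, map_pow]
    linear_combination hawc + x ^ (n + 1) * hc'

theorem mem_of_pow_mul_mem_of_one_sub_mul_mem {k A : Type*} [CommRing k] [CommRing A] [Algebra k A]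
    (T : Subalgebra k A) {b t : A} (hb : b ∈ T) (n : ℕ) (hpow : b ^ n * t ∈ T)
    (hone : (1 - b) * t ∈ T) : t ∈ T := by
  have ht : t = (∑ i ∈ Finset.range n, b ^ i) * ((1 - b) * t) + b ^ n * t := by
    linear_combination -t * geom_sum_mul_neg b n
  rw [ht]
  exact add_mem (mul_mem (sum_mem fun i _ => pow_mem hb i) hone) hpow

theorem IsPoint.exists_reduced_generator (h : S.IsPoint x y z t) :
    ∃ t' w, S.IsReduced w ∧ x ^ S.e * t' = y ^ S.s + evalXYZ x y z w ∧
      t ∈ Algebra.adjoin k {x, y, z, t'} := by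
  obtain ⟨n, hn⟩ : ∃ n, S.e = n + 1 := ⟨S.e - 1, by have := S.e_pos; omega⟩
  obtain ⟨a, w, c, hw, hawc⟩ := exists_mul_evalXYZ_Q_eq h.pow_d_mul n
  set α := evalXYZ x y z a
  set κ := evalXYZ x y z c
  have hQ := h.pow_e_mul
  rw [hn] at hQ ⊢
  refine ⟨(1 + x * α) * t - κ, w, hw, by linear_combination hawc + (1 + x * α) * hQ, ?_⟩
  set t' := (1 + x * α) * t - κ with ht'
  let T := Algebra.adjoin k {x, y, z, t'}
  have hx : x ∈ T := Algebra.subset_adjoin (by simp)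
  have hy : y ∈ T := Algebra.subset_adjoin (by simp)
  have hz : z ∈ T := Algebra.subset_adjoin (by simp)
  have hα : α ∈ T := evalXYZ_mem_subalgebra T hx hy hz a
  refine mem_of_pow_mul_mem_of_one_sub_mul_mem T (b := -(x * α)) (neg_mem (mul_mem hx hα)) (n + 1)
    ?_ ?_
  · rw [show (-(x * α)) ^ (n + 1) * t = (-α) ^ (n + 1) * (x ^ (n + 1) * t) by
      rw [← mul_neg, mul_pow]; ring, hQ]
    exact mul_mem (pow_mem (neg_mem hα) _) (evalXYZ_mem_subalgebra T hx hy hz _)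
  · rw [show (1 - -(x * α)) * t = t' + κ by rw [ht']; ring]
    exact add_mem (Algebra.subset_adjoin (by simp)) (evalXYZ_mem_subalgebra T hx hy hz c)

/-- The monomial `x ^ l * z ^ i * y ^ j * t ^ m` attached to the exponent `(l, i, j, m)`. -/
def stripMonomial (x y z t : A) (n : ℕ × ℕ × ℕ × ℕ) : A :=
  x ^ n.1 * z ^ n.2.1 * y ^ n.2.2.1 * t ^ n.2.2.2

variable (S) in
/-- The exponents `(l, i, j, m)` with `i < r` and `j < s`: the corresponding monomials will form a
basis of the coordinate ring. -/
def strip : Set (ℕ × ℕ × ℕ × ℕ) :=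
  {n | n.2.1 < S.r ∧ n.2.2.1 < S.s}

theorem stripMonomial_mem_span {l i j m : ℕ} (hi : i < S.r) (hj : j < S.s) :
    x ^ l * z ^ i * y ^ j * t ^ m ∈ Submodule.span k (stripMonomial x y z t '' S.strip) :=
  Submodule.subset_span ⟨(l, i, j, m), ⟨hi, hj⟩, rfl⟩

theorem x_mem_multiplierSubalgebra_strip :
    x ∈ multiplierSubalgebra (Submodule.span k (stripMonomial x y z t '' S.strip)) := by
  refine mem_multiplierSubalgebra_span ?_
  rintro _ ⟨⟨l, i, j, m⟩, ⟨hi, hj⟩, rfl⟩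
  have := stripMonomial_mem_span (x := x) (y := y) (z := z) (t := t) (l := l + 1) (m := m) hi hj
  convert this using 1
  simp only [stripMonomial]
  ring

theorem t_mem_multiplierSubalgebra_strip :
    t ∈ multiplierSubalgebra (Submodule.span k (stripMonomial x y z t '' S.strip)) := by
  refine mem_multiplierSubalgebra_span ?_
  rintro _ ⟨⟨l, i, j, m⟩, ⟨hi, hj⟩, rfl⟩
  have := stripMonomial_mem_span (x := x) (y := y) (z := z) (t := t) (l := l) (m := m + 1) hi hj
  convert this using 1
  simp only [stripMonomial]
  ring

theorem evalXYZ_mem_span_strip {w : k[X][X][X]} (hw : S.IsReduced w) :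
    evalXYZ x y z w ∈ Submodule.span k (stripMonomial x y z t '' S.strip) := by
  rw [evalXYZ, eval₂_eq_sum]
  refine Submodule.sum_mem _ fun j hj => ?_
  have hjs : j < S.s := by exact_mod_cast (le_degree_of_mem_supp j hj).trans_lt hw.1
  change evalXZ x z (w.coeff j) * y ^ j ∈ _
  rw [evalXZ, eval₂_eq_sum, Polynomial.sum, Finset.sum_mul]
  refine Submodule.sum_mem _ fun i hi => ?_
  have hir : i < S.r := by exact_mod_cast (le_degree_of_mem_supp i hi).trans_lt (hw.2 j)
  have := aeval_mem_subalgebra _ x_mem_multiplierSubalgebra_strip ((w.coeff j).coeff i) _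
    (stripMonomial_mem_span (k := k) (x := x) (y := y) (z := z) (t := t) (l := 0) (m := 0) hir hjs)
  convert this using 1
  simp [mul_assoc]

theorem y_pow_mem_span_strip (hr : 0 < S.r) (hs : 0 < S.s) {w : k[X][X][X]} (hw : S.IsReduced w)
    (h : x ^ S.e * t = y ^ S.s + evalXYZ x y z w) {j : ℕ} (hj : j ≤ S.s) :
    y ^ j ∈ Submodule.span k (stripMonomial x y z t '' S.strip) := by
  rcases hj.lt_or_eq with hj | rfl
  · simpa using stripMonomial_mem_span (k := k) (x := x) (y := y) (z := z) (t := t)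
      (l := 0) (m := 0) hr hj
  · rw [show y ^ S.s = x ^ S.e * t - evalXYZ x y z w by rw [h]; ring]
    refine sub_mem (pow_mem x_mem_multiplierSubalgebra_strip S.e _ ?_) (evalXYZ_mem_span_strip hw)
    simpa using stripMonomial_mem_span (k := k) (x := x) (y := y) (z := z) (t := t)
      (l := 0) (m := 1) hr hs

theorem z_mem_multiplierSubalgebra_strip (hr : 0 < S.r) (hs : 0 < S.s)
    (hP : x ^ S.d * y = evalXZ x z S.P) {w : k[X][X][X]} (hw : S.IsReduced w)
    (h : x ^ S.e * t = y ^ S.s + evalXYZ x y z w) :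
    z ∈ multiplierSubalgebra (Submodule.span k (stripMonomial x y z t '' S.strip)) := by
  refine mem_multiplierSubalgebra_span ?_
  rintro _ ⟨⟨l, i, j, m⟩, ⟨hi, hj⟩, rfl⟩
  simp only [stripMonomial]
  rcases (Nat.add_one_le_of_lt hi).lt_or_eq with hi | hi
  · rw [show z * (x ^ l * z ^ i * y ^ j * t ^ m) = x ^ l * z ^ (i + 1) * y ^ j * t ^ m by ring]
    exact stripMonomial_mem_span hi hj
  have hz : z ^ (i + 1) =
      x ^ S.d * y - ∑ n ∈ Finset.range S.r, aeval x (S.P.coeff n) * z ^ n := by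
    rw [hP, evalXZ_monic S.P_monic, ← DoubleDanielewski.r, ← hi]
    ring
  have hmul : z * (x ^ l * z ^ i * y ^ j * t ^ m) = x ^ (S.d + l) * (t ^ m * y ^ (j + 1)) -
      ∑ n ∈ Finset.range S.r, aeval x (S.P.coeff n) * (x ^ l * z ^ n * y ^ j * t ^ m) := by
    have hsum : ∑ n ∈ Finset.range S.r, aeval x (S.P.coeff n) * (x ^ l * z ^ n * y ^ j * t ^ m) =
        (∑ n ∈ Finset.range S.r, aeval x (S.P.coeff n) * z ^ n) * (x ^ l * y ^ j * t ^ m) := by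
      rw [Finset.sum_mul]
      exact Finset.sum_congr rfl fun _ _ => by ring
    rw [hsum]
    linear_combination x ^ l * y ^ j * t ^ m * hz
  rw [hmul]
  refine sub_mem (pow_mem x_mem_multiplierSubalgebra_strip _ _
    (pow_mem t_mem_multiplierSubalgebra_strip _ _ (y_pow_mem_span_strip hr hs hw h hj))) ?_
  exact sum_mem fun n hn => aeval_mem_subalgebra _ x_mem_multiplierSubalgebra_strip _ _
    (stripMonomial_mem_span (Finset.mem_range.1 hn) hj)

theorem adjoin_le_span_strip (hr : 0 < S.r) (hs : 0 < S.s)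
    (hP : x ^ S.d * y = evalXZ x z S.P) {w : k[X][X][X]} (hw : S.IsReduced w)
    (h : x ^ S.e * t = y ^ S.s + evalXYZ x y z w) :
    Subalgebra.toSubmodule (Algebra.adjoin k {x, y, z, t}) ≤
      Submodule.span k (stripMonomial x y z t '' S.strip) := by
  have hz := z_mem_multiplierSubalgebra_strip hr hs hP hw h
  have hy : y ∈ multiplierSubalgebra (Submodule.span k (stripMonomial x y z t '' S.strip)) := by
    refine mem_multiplierSubalgebra_span ?_
    rintro _ ⟨⟨l, i, j, m⟩, ⟨-, hj⟩, rfl⟩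
    rw [show y * stripMonomial x y z t (l, i, j, m) =
      x ^ l * (z ^ i * (t ^ m * y ^ (j + 1))) by simp only [stripMonomial]; ring]
    exact pow_mem x_mem_multiplierSubalgebra_strip _ _ (pow_mem hz _ _
      (pow_mem t_mem_multiplierSubalgebra_strip _ _ (y_pow_mem_span_strip hr hs hw h hj)))
  refine adjoin_le_of_le_multiplierSubalgebra ?_ ?_
  · simpa using y_pow_mem_span_strip hr hs hw h (Nat.zero_le _)
  · rintro a (rfl | rfl | rfl | rfl)
    exacts [x_mem_multiplierSubalgebra_strip, hy, hz, t_mem_multiplierSubalgebra_strip]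

end DoubleDanielewski

/-! ### Hahn series models -/

section HahnSeriesOrder

open HahnSeries

variable {Γ R : Type*} [LinearOrder Γ]

theorem lt_orderTop_sum [AddCommMonoid R] {ι : Type*} {f : ι → HahnSeries Γ R} {s : Finset ι}
    {γ : Γ} (h : ∀ i ∈ s, (γ : WithTop Γ) < (f i).orderTop) : γ < (∑ i ∈ s, f i).orderTop :=
  Finset.sum_induction f (fun g => (γ : WithTop Γ) < g.orderTop)
    (fun _ _ hg hg' => (lt_min hg hg').trans_le min_orderTop_le_orderTop_add) (by simp) h

theorem exists_orderTop_sum_eq [AddCommMonoid R] {ι : Type*} {f : ι → HahnSeries Γ R} {W : ι → Γ}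
    {s : Finset ι} (hs : s.Nonempty) (hW : ∀ i ∈ s, (f i).orderTop = W i) (inj : Set.InjOn W s) :
    ∃ i ∈ s, (∀ j ∈ s, W i ≤ W j) ∧ (∑ j ∈ s, f j).orderTop = W i := by
  classical
  obtain ⟨i, hi, hmin⟩ := s.exists_min_image W hs
  refine ⟨i, hi, hmin, ?_⟩
  rw [← Finset.add_sum_erase s f hi, orderTop_add_eq_left, hW i hi]
  rw [hW i hi]
  refine lt_orderTop_sum fun j hj => ?_
  obtain ⟨hji, hj⟩ := Finset.mem_erase.1 hj
  rw [hW j hj, WithTop.coe_lt_coe]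
  exact (hmin j hj).lt_of_ne fun h => hji (inj hj hi h.symm)

theorem orderTop_smul_of_ne_zero [Field R] {c : R} (hc : c ≠ 0) (h : HahnSeries Γ R) :
    (c • h).orderTop = h.orderTop := by
  refine le_antisymm ?_ (orderTop_le_orderTop_smul c h)
  simpa [smul_smul, hc] using orderTop_le_orderTop_smul c⁻¹ (c • h)

theorem lt_orderTop_smul_sub_smul [Field R] {f g : HahnSeries Γ R} {γ : Γ} (hf : f.orderTop = γ)
    (hg : g.orderTop = γ) :
    (γ : WithTop Γ) < (g.coeff γ • f - f.coeff γ • g).orderTop := by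
  refine lt_of_le_of_ne ?_ fun h => coeff_orderTop_ne h.symm ?_
  · refine le_trans (le_min ?_ ?_) min_orderTop_le_orderTop_sub
    · rw [orderTop_smul_of_ne_zero (coeff_orderTop_ne hg), hf]
    · rw [orderTop_smul_of_ne_zero (coeff_orderTop_ne hf), hg]
  · simp [mul_comm]

theorem exists_orderTop_eq_and_mem_span {k A I : Type*} [Field k] [AddCommGroup A] [Module k A]
    {f : A →ₗ[k] HahnSeries Γ k} {v : I → A} {W : I → Γ} {s : Set I} (inj : Set.InjOn W s)
    (hW : ∀ n ∈ s, (f (v n)).orderTop = W n) {a : A} (ha : a ∈ Submodule.span k (v '' s))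
    (ha0 : a ≠ 0) : ∃ n ∈ s, (f a).orderTop = W n ∧
      a ∈ Submodule.span k (v '' {m ∈ s | W n ≤ W m}) := by
  obtain ⟨c, hc, rfl⟩ := Finsupp.mem_span_image_iff_linearCombination k |>.1 ha
  rw [Finsupp.linearCombination_apply, Finsupp.sum] at ha0 ⊢
  obtain ⟨n, hn, hmin, hsum⟩ := exists_orderTop_sum_eq (f := fun m => f (c m • v m))
    (Finset.nonempty_of_sum_ne_zero ha0) (fun m hm => by
      rw [map_smul, orderTop_smul_of_ne_zero (Finsupp.mem_support_iff.1 hm), hW m (hc hm)])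
    (inj.mono hc)
  refine ⟨n, hc hn, by rw [map_sum, hsum], Submodule.sum_mem _ fun m hm => ?_⟩
  exact Submodule.smul_mem _ _ (Submodule.subset_span ⟨m, ⟨hc hm, hmin m hm⟩, rfl⟩)

variable [AddCommMonoid Γ] [IsOrderedCancelAddMonoid Γ] [Semiring R] [NoZeroDivisors R]

theorem orderTop_mul_of_eq {f g : HahnSeries Γ R} {γ γ' : Γ} (hf : f.orderTop = γ)
    (hg : g.orderTop = γ') : (f * g).orderTop = (γ + γ' : Γ) := by
  rw [orderTop_mul, hf, hg, WithTop.coe_add]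

theorem orderTop_pow_of_eq [Nontrivial R] {f : HahnSeries Γ R} {γ : Γ} (hf : f.orderTop = γ)
    (n : ℕ) : (f ^ n).orderTop = (n • γ : Γ) := by
  induction n with
  | zero => simp
  | succ n ih => rw [pow_succ, succ_nsmul, orderTop_mul_of_eq ih hf]

end HahnSeriesOrder

section LexPair

/-- The element `(u, v)` of `ℚ × ℚ` with the lexicographic order, our group of weights. -/
def lexPair (u v : ℚ) : ℚ ×ₗ ℚ :=
  toLex (u, v)

theorem lexPair_add (u v u' v' : ℚ) :
    lexPair u v + lexPair u' v' = lexPair (u + u') (v + v') := rfl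

theorem lexPair_zero : lexPair 0 0 = 0 := rfl

theorem nsmul_lexPair (n : ℕ) (u v : ℚ) : n • lexPair u v = lexPair (n * u) (n * v) := by
  rw [← nsmul_eq_mul, ← nsmul_eq_mul]
  rfl

theorem lexPair_lt_lexPair {u v u' v' : ℚ} :
    lexPair u v < lexPair u' v' ↔ u < u' ∨ u = u' ∧ v < v' :=
  Prod.Lex.toLex_lt_toLex

theorem lexPair_le_lexPair {u v u' v' : ℚ} :
    lexPair u v ≤ lexPair u' v' ↔ u < u' ∨ u = u' ∧ v ≤ v' :=
  Prod.Lex.toLex_le_toLex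

theorem lexPair_inj {u v u' v' : ℚ} : lexPair u v = lexPair u' v' ↔ u = u' ∧ v = v' :=
  toLex_inj.trans Prod.mk_inj

end LexPair

section LexSeries

open HahnSeries

variable (k : Type*) [Field k]

/-- The series `X`, of order `(0, 1)`. -/
noncomputable def lexX : HahnSeries (ℚ ×ₗ ℚ) k :=
  single (lexPair 0 1) 1

/-- The series `Z`, of order `(-1, 0)`. -/
noncomputable def lexZ : HahnSeries (ℚ ×ₗ ℚ) k :=
  single (lexPair (-1) 0) 1

theorem orderTop_lexX : (lexX k).orderTop = lexPair 0 1 :=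
  orderTop_single one_ne_zero

theorem orderTop_lexZ : (lexZ k).orderTop = lexPair (-1) 0 :=
  orderTop_single one_ne_zero

variable {k}

theorem lexX_pow_mul_single_mul (n : ℕ) (h : HahnSeries (ℚ ×ₗ ℚ) k) :
    lexX k ^ n * (single (lexPair 0 (-n)) 1 * h) = h := by
  rw [← mul_assoc, lexX, single_pow, nsmul_lexPair, single_mul_single, lexPair_add, mul_zero,
    mul_one, add_zero, add_neg_cancel, one_pow, mul_one, lexPair_zero]
  exact one_mul h

theorem orderTop_aeval_of_eq {x : HahnSeries (ℚ ×ₗ ℚ) k} (hx : x.orderTop = lexPair 0 1) {p : k[X]}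
    (hp : p ≠ 0) : (aeval x p).orderTop = lexPair 0 p.natTrailingDegree := by
  obtain ⟨m, hm, hmin, h⟩ := exists_orderTop_sum_eq (s := p.support)
    (f := fun i => p.coeff i • x ^ i) (W := fun i : ℕ => lexPair 0 i)
    (support_nonempty.2 hp) (fun i hi => by
      rw [orderTop_smul_of_ne_zero (mem_support_iff.1 hi), orderTop_pow_of_eq hx,
        nsmul_lexPair, mul_zero, mul_one])
    (fun i _ j _ h => Nat.cast_injective (lexPair_inj.1 h).2)
  have hm' : m = p.natTrailingDegree := by
    refine le_antisymm ?_ (natTrailingDegree_le_of_mem_supp m hm)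
    have := hmin _ (natTrailingDegree_mem_support_of_nonzero hp)
    simpa [lexPair_le_lexPair] using this
  rw [← hm', ← h, aeval_def, eval₂_eq_sum, sum_def]
  simp only [Algebra.smul_def]

theorem orderTop_evalXZ_of_eq {x z : HahnSeries (ℚ ×ₗ ℚ) k} (hx : x.orderTop = lexPair 0 1)
    {n v : ℚ} (hn : 0 < n) (hz : z.orderTop = lexPair (-n) v) {q : k[X][X]} (hq : q ≠ 0) :
    (evalXZ x z q).orderTop =
      lexPair (-(q.natDegree * n)) (q.leadingCoeff.natTrailingDegree + q.natDegree * v) := by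
  obtain ⟨i, hi, hmin, h⟩ := exists_orderTop_sum_eq (s := q.support)
    (f := fun i => aeval x (q.coeff i) * z ^ i)
    (W := fun i : ℕ => lexPair (-(i * n)) ((q.coeff i).natTrailingDegree + i * v))
    (support_nonempty.2 hq) (fun i hi => by
      rw [orderTop_mul_of_eq (orderTop_aeval_of_eq hx (mem_support_iff.1 hi))
        (orderTop_pow_of_eq hz i), nsmul_lexPair, lexPair_add, zero_add, mul_neg])
    (fun i _ j _ h => by simpa [hn.ne'] using (lexPair_inj.1 h).1)
  have hid : i = q.natDegree := by
    refine le_antisymm (le_natDegree_of_mem_supp i hi) ?_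
    have hle : (q.natDegree : ℚ) * n ≤ i * n := by
      rcases lexPair_le_lexPair.1 (hmin _ (natDegree_mem_support_of_nonzero hq)) with h | ⟨h, -⟩ <;>
        linarith
    exact_mod_cast le_of_mul_le_mul_right hle hn
  rw [Polynomial.leadingCoeff, ← hid, ← h, evalXZ, eval₂_eq_sum, sum_def]
  rfl

theorem orderTop_evalXZ {x z : HahnSeries (ℚ ×ₗ ℚ) k} (hx : x.orderTop = lexPair 0 1)
    (hz : z.orderTop = lexPair (-1) 0) {q : k[X][X]} (hq : q ≠ 0) :
    (evalXZ x z q).orderTop = lexPair (-q.natDegree) q.leadingCoeff.natTrailingDegree := by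
  simpa using orderTop_evalXZ_of_eq hx one_pos hz hq

end LexSeries

namespace DoubleDanielewski

open HahnSeries

variable {k : Type*} [Field k] (S : DoubleDanielewski k)

/-- The order of the monomial with exponent `(l, i, j, m)` when `x`, `z`, `y`, `t` have the orders
`(0, 1)`, `(-1, 0)`, `(-r, -d)`, `(-r s, -(d s + e))`. -/
noncomputable def lexWeight (n : ℕ × ℕ × ℕ × ℕ) : ℚ ×ₗ ℚ :=
  lexPair (-(n.2.1 + S.r * n.2.2.1 + S.r * S.s * n.2.2.2))
    (n.1 - S.d * n.2.2.1 - (S.d * S.s + S.e) * n.2.2.2)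

theorem injOn_lexWeight : Set.InjOn S.lexWeight S.strip := by
  rintro ⟨l, i, j, m⟩ ⟨hi, hj⟩ ⟨l', i', j', m'⟩ ⟨hi', hj'⟩ h
  dsimp only at hi hj hi' hj'
  obtain ⟨h₁, h₂⟩ := lexPair_inj.1 h
  dsimp only at h₁ h₂
  have hZ : i + S.r * (j + S.s * m) = i' + S.r * (j' + S.s * m') := by
    have : (i + S.r * (j + S.s * m) : ℚ) = i' + S.r * (j' + S.s * m') := by linarith
    exact_mod_cast this
  obtain rfl : i = i' := by
    simpa [Nat.add_mul_mod_self_left, Nat.mod_eq_of_lt, hi, hi'] using congrArg (· % S.r) hZ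
  have hY : j + S.s * m = j' + S.s * m' :=
    Nat.eq_of_mul_eq_mul_left (Nat.zero_lt_of_lt hi) (add_left_cancel hZ)
  obtain rfl : j = j' := by
    simpa [Nat.add_mul_mod_self_left, Nat.mod_eq_of_lt, hj, hj'] using congrArg (· % S.s) hY
  obtain rfl : m = m' := Nat.eq_of_mul_eq_mul_left (Nat.zero_lt_of_lt hj) (add_left_cancel hY)
  obtain rfl : l = l' := by
    have : (l : ℚ) = l' := by linarith
    exact_mod_cast this
  rfl

/-- A homomorphism from the coordinate ring to a ring of Hahn series, together with a new generator
`t` for which the strip monomials span the coordinate ring and have pairwise distinct orders. -/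
structure LexModel where
  toHahn : S.B →ₐ[k] HahnSeries (ℚ ×ₗ ℚ) k
  t : S.B
  toHahn_x : toHahn S.x = lexX k
  toHahn_z : toHahn S.z = lexZ k
  orderTop_y : (toHahn S.y).orderTop = lexPair (-S.r) (-S.d)
  orderTop_t : (toHahn t).orderTop = lexPair (-(S.r * S.s)) (-(S.d * S.s + S.e))
  span_strip_eq_top : Submodule.span k (stripMonomial S.x S.y S.z t '' S.strip) = ⊤

variable {S}

theorem orderTop_stripMonomial {φ : S.B →ₐ[k] HahnSeries (ℚ ×ₗ ℚ) k} (hx : φ S.x = lexX k)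
    (hz : φ S.z = lexZ k) (hy : (φ S.y).orderTop = lexPair (-S.r) (-S.d)) {t : S.B}
    (ht : (φ t).orderTop = lexPair (-(S.r * S.s)) (-(S.d * S.s + S.e))) (n : ℕ × ℕ × ℕ × ℕ) :
    (φ (stripMonomial S.x S.y S.z t n)).orderTop = S.lexWeight n := by
  simp only [stripMonomial, map_mul, map_pow, hx, hz]
  rw [orderTop_mul_of_eq (orderTop_mul_of_eq (orderTop_mul_of_eq
    (orderTop_pow_of_eq (orderTop_lexX k) n.1) (orderTop_pow_of_eq (orderTop_lexZ k) n.2.1))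
    (orderTop_pow_of_eq hy n.2.2.1)) (orderTop_pow_of_eq ht n.2.2.2)]
  simp only [nsmul_lexPair, lexPair_add, lexWeight]
  congr 2 <;> ring

theorem lt_orderTop_evalXYZ_of_isReduced {φ : S.B →ₐ[k] HahnSeries (ℚ ×ₗ ℚ) k}
    (hx : φ S.x = lexX k) (hz : φ S.z = lexZ k)
    (hy : (φ S.y).orderTop = lexPair (-S.r) (-S.d)) {w : k[X][X][X]} (hw : S.IsReduced w) :
    ((S.s • lexPair (-S.r) (-S.d) : ℚ ×ₗ ℚ) : WithTop (ℚ ×ₗ ℚ)) <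
      (φ (evalXYZ S.x S.y S.z w)).orderTop := by
  rw [algHom_evalXYZ, hx, hz, evalXYZ, eval₂_eq_sum]
  refine lt_orderTop_sum fun j hj => ?_
  change _ < (evalXZ (lexX k) (lexZ k) (w.coeff j) * φ S.y ^ j).orderTop
  rw [orderTop_mul_of_eq
      (orderTop_evalXZ (orderTop_lexX k) (orderTop_lexZ k) (mem_support_iff.1 hj))
    (orderTop_pow_of_eq hy j), WithTop.coe_lt_coe, nsmul_lexPair, nsmul_lexPair, lexPair_add,
    lexPair_lt_lexPair]
  have hjs : j < S.s := by exact_mod_cast (le_degree_of_mem_supp j hj).trans_lt hw.1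
  have hir := natDegree_lt_iff_degree_lt (mem_support_iff.1 hj) |>.2 (hw.2 j)
  have h : (w.coeff j).natDegree + j * S.r < S.s * S.r := by
    calc (w.coeff j).natDegree + j * S.r < (j + 1) * S.r := by rw [add_mul]; omega
      _ ≤ S.s * S.r := Nat.mul_le_mul_right _ hjs
  have h' : ((w.coeff j).natDegree + j * S.r : ℚ) < S.s * S.r := by exact_mod_cast h
  left
  linarith

variable (S) in
theorem exists_toHahn : ∃ φ : S.B →ₐ[k] HahnSeries (ℚ ×ₗ ℚ) k, φ S.x = lexX k ∧ φ S.z = lexZ k ∧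
    (φ S.y).orderTop = lexPair (-S.r) (-S.d) := by
  set Y : HahnSeries (ℚ ×ₗ ℚ) k :=
    single (lexPair 0 (-S.d)) 1 * evalXZ (lexX k) (lexZ k) S.P with hY
  have h : S.IsPoint (lexX k) Y (lexZ k)
      (single (lexPair 0 (-S.e)) 1 * evalXYZ (lexX k) Y (lexZ k) S.Q) :=
    ⟨lexX_pow_mul_single_mul _ _, lexX_pow_mul_single_mul _ _⟩
  refine ⟨h.lift, h.lift_x, h.lift_z, ?_⟩
  rw [h.lift_y, hY, orderTop_mul_of_eq (orderTop_single one_ne_zero)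
    (orderTop_evalXZ (orderTop_lexX k) (orderTop_lexZ k) S.P_monic.ne_zero), S.P_monic.leadingCoeff,
    lexPair_add, r]
  simp

theorem nonempty_lexModel (hr : 0 < S.r) (hs : 0 < S.s) : Nonempty S.LexModel := by
  obtain ⟨φ, hx, hz, hy⟩ := S.exists_toHahn
  obtain ⟨t', w, hw, ht', htmem⟩ := S.isPoint.exists_reduced_generator
  refine ⟨φ, t', hx, hz, hy, ?_, ?_⟩
  · have hys := orderTop_pow_of_eq hy S.s
    have h := congrArg (fun b => (φ b).orderTop) ht'
    simp only [map_mul, map_pow, map_add] at h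
    rw [orderTop_add_eq_left (hys ▸ lt_orderTop_evalXYZ_of_isReduced hx hz hy hw), hys,
      orderTop_mul, hx, orderTop_pow_of_eq (orderTop_lexX k) S.e] at h
    cases hc : (φ t').orderTop with
    | top =>
      rw [hc, WithTop.add_top] at h
      exact absurd h WithTop.top_ne_coe
    | coe a =>
      rw [hc, ← WithTop.coe_add, WithTop.coe_inj] at h
      rw [WithTop.coe_inj]
      refine add_left_cancel (h.trans ?_)
      rw [nsmul_lexPair, nsmul_lexPair, lexPair_add]
      congr 1 <;> ring
  · have hle : Algebra.adjoin k {S.x, S.y, S.z, S.t} ≤ Algebra.adjoin k {S.x, S.y, S.z, t'} := by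
      refine Algebra.adjoin_le ?_
      rintro _ (rfl | rfl | rfl | rfl)
      exacts [Algebra.subset_adjoin (by simp), Algebra.subset_adjoin (by simp),
        Algebra.subset_adjoin (by simp), htmem]
    refine eq_top_iff.2 fun a _ => adjoin_le_span_strip hr hs S.isPoint.pow_d_mul hw ht' (hle ?_)
    rw [S.adjoin_generators_eq_top]
    trivial

namespace LexModel

variable (M : S.LexModel)

theorem orderTop_x : (M.toHahn S.x).orderTop = lexPair 0 1 := by
  rw [M.toHahn_x, orderTop_lexX]

theorem orderTop_z : (M.toHahn S.z).orderTop = lexPair (-1) 0 := by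
  rw [M.toHahn_z, orderTop_lexZ]

theorem orderTop_evalXZ {p : k[X][X]} (hp : p ≠ 0) : (M.toHahn (evalXZ S.x S.z p)).orderTop =
    lexPair (-p.natDegree) p.leadingCoeff.natTrailingDegree := by
  rw [algHom_evalXZ, _root_.orderTop_evalXZ M.orderTop_x M.orderTop_z hp]

theorem exists_orderTop_eq_and_mem_span {a : S.B} (ha : a ≠ 0) :
    ∃ n ∈ S.strip, (M.toHahn a).orderTop = S.lexWeight n ∧
      a ∈ Submodule.span k
        (stripMonomial S.x S.y S.z M.t '' {m ∈ S.strip | S.lexWeight n ≤ S.lexWeight m}) :=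
  _root_.exists_orderTop_eq_and_mem_span (f := M.toHahn.toLinearMap) S.injOn_lexWeight
    (fun n _ => orderTop_stripMonomial M.toHahn_x M.toHahn_z M.orderTop_y M.orderTop_t n)
    (M.span_strip_eq_top ▸ Submodule.mem_top) ha

theorem toHahn_injective : Function.Injective M.toHahn := by
  rw [injective_iff_map_eq_zero]
  intro a h
  by_contra ha
  obtain ⟨n, -, hn, -⟩ := M.exists_orderTop_eq_and_mem_span ha
  simp [h] at hn

theorem exists_eq_evalXZ {n : ℕ} (hn : n ≤ S.r) {a : S.B}
    (ha : ∀ v : ℚ, (lexPair (-n) v : WithTop (ℚ ×ₗ ℚ)) < (M.toHahn a).orderTop) :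
    ∃ f : k[X][X], f.degree < n ∧ a = evalXZ S.x S.z f := by
  by_cases h0 : a = 0
  · exact ⟨0, by simp, by simp [h0, ← evalXZHom_apply]⟩
  obtain ⟨n₀, -, ho, hmem⟩ := M.exists_orderTop_eq_and_mem_span h0
  suffices hle : Submodule.span k
      (stripMonomial S.x S.y S.z M.t '' {m ∈ S.strip | S.lexWeight n₀ ≤ S.lexWeight m}) ≤
        ((degreeLT k[X] n).restrictScalars k).map (evalXZHom S.x S.z).toLinearMap by
    obtain ⟨f, hf, rfl⟩ := hle hmem
    exact ⟨f, mem_degreeLT.1 hf, rfl⟩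
  refine Submodule.span_le.2 ?_
  rintro _ ⟨⟨l, i, j, m⟩, ⟨⟨hi, hj⟩, hle⟩, rfl⟩
  dsimp only at hi hj
  have hlt : i + S.r * (j + S.s * m) < n := by
    have h := (WithTop.coe_lt_coe.1 (ho ▸ ha (l - S.d * j - (S.d * S.s + S.e) * m))).trans_le hle
    have : (i + S.r * (j + S.s * m) : ℚ) < n := by
      rcases lexPair_lt_lexPair.1 h with h | ⟨-, h⟩
      · dsimp only at h
        linarith
      · exact absurd h (lt_irrefl _)
    exact_mod_cast this
  have hjm : j + S.s * m = 0 := by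
    by_contra h
    have := Nat.le_mul_of_pos_right S.r (Nat.pos_of_ne_zero h)
    omega
  obtain ⟨rfl, hm⟩ : j = 0 ∧ S.s * m = 0 := by omega
  obtain rfl : m = 0 := (Nat.mul_eq_zero.1 hm).resolve_left hj.ne'
  have hin : i < n := by simpa using hlt
  refine ⟨Polynomial.C (X ^ l) * X ^ i, ?_, ?_⟩
  · rw [SetLike.mem_coe, Submodule.restrictScalars_mem, mem_degreeLT]
    exact (degree_C_mul_X_pow_le _ _).trans_lt (by exact_mod_cast hin)
  · simp only [AlgHom.toLinearMap_apply, evalXZHom_apply, evalXZ_mul, evalXZ_C, evalXZ_pow,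
      evalXZ_X, map_pow, aeval_X, stripMonomial, pow_zero, mul_one]

end LexModel

theorem isDomain_B (hr : 0 < S.r) (hs : 0 < S.s) : IsDomain S.B :=
  let ⟨M⟩ := nonempty_lexModel hr hs
  M.toHahn_injective.isDomain M.toHahn.toRingHom

theorem x_ne_zero (hr : 0 < S.r) (hs : 0 < S.s) : S.x ≠ 0 := by
  obtain ⟨M⟩ := nonempty_lexModel hr hs
  intro h
  simpa [h] using M.orderTop_x

theorem evalXZ_injective (hr : 0 < S.r) (hs : 0 < S.s) :
    Function.Injective (evalXZ S.x S.z : k[X][X] → S.B) := by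
  obtain ⟨M⟩ := nonempty_lexModel hr hs
  refine (injective_iff_map_eq_zero (evalXZHom S.x S.z)).2 fun p hp => ?_
  by_contra h
  have ho := M.orderTop_evalXZ h
  rw [← evalXZHom_apply, hp, map_zero] at ho
  simp at ho

theorem aeval_x_injective (hr : 0 < S.r) (hs : 0 < S.s) :
    Function.Injective (aeval S.x : k[X] → S.B) := fun p q h =>
  C_injective (evalXZ_injective hr hs (by rwa [evalXZ_C, evalXZ_C]))

end DoubleDanielewski

/-! ### Leading forms of exponential maps -/

section PolynomialPowers

theorem coeff_geom_sum₂ {R : Type*} [CommSemiring R] {p q : R[X]} {N : ℕ} (hp : p.natDegree ≤ N)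
    (hq : q.natDegree ≤ N) (n : ℕ) :
    (∑ i ∈ Finset.range n, p ^ i * q ^ (n - 1 - i)).coeff ((n - 1) * N) =
      ∑ i ∈ Finset.range n, p.coeff N ^ i * q.coeff N ^ (n - 1 - i) := by
  rw [finsetSum_coeff]
  refine Finset.sum_congr rfl fun i hi => ?_
  have hi' : n - 1 = i + (n - 1 - i) := by have := Finset.mem_range.1 hi; omega
  conv_lhs => rw [hi', Nat.add_sub_cancel_left, add_mul]
  rw [coeff_mul_add_eq_of_natDegree_le (natDegree_pow_le_of_le i hp) (natDegree_pow_le_of_le _ hq),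
    coeff_pow_of_natDegree_le hp, coeff_pow_of_natDegree_le hq]

theorem exists_coeff_pow_ne_zero {R : Type*} [CommRing R] [IsDomain R] {E : R[X]} {l : ℕ}
    (hE : 0 < E.natDegree) (h0 : E.coeff 0 ≠ 0) (hl : (l : R) ≠ 0) :
    ∃ i < E.natDegree, (E ^ l).coeff ((l - 1) * E.natDegree + i) ≠ 0 := by
  set N := E.natDegree with hN
  set T : R[X] := C E.leadingCoeff * X ^ N with hT
  have hE0 : E ≠ 0 := by rintro rfl; simp at h0
  have hET : E.coeff N = T.coeff N := by simp [hT, hN]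
  have hsub : E - T = E.eraseLead := self_sub_C_mul_X_pow E
  have hD : E.eraseLead ≠ 0 := by
    intro h
    apply h0
    rw [← eraseLead_coeff_of_ne 0 hE.ne, h, coeff_zero]
  have hDN : E.eraseLead.natDegree < N :=
    (eraseLead_natDegree_lt_or_eraseLead_eq_zero E).resolve_right hD
  have hpow : E ^ l = (∑ i ∈ Finset.range l, E ^ i * T ^ (l - 1 - i)) * E.eraseLead + T ^ l := by
    rw [← hsub, geom_sum₂_mul, sub_add_cancel]
  have hT0 : (T ^ l).coeff ((l - 1) * N + E.eraseLead.natDegree) = 0 := by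
    obtain ⟨n, rfl⟩ : ∃ n, l = n + 1 := Nat.exists_eq_succ_of_ne_zero (by rintro rfl; simp at hl)
    rw [hT, mul_pow, ← pow_mul, ← C_pow, coeff_C_mul, coeff_X_pow, if_neg, mul_zero]
    rw [mul_comm N, Nat.add_sub_cancel, add_mul]
    omega
  have hTN : T.natDegree ≤ N := natDegree_C_mul_X_pow_le _ _
  have hle : (∑ i ∈ Finset.range l, E ^ i * T ^ (l - 1 - i)).natDegree ≤ (l - 1) * N := by
    refine natDegree_sum_le_of_forall_le _ _ fun i hi => natDegree_mul_le.trans ?_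
    calc (E ^ i).natDegree + (T ^ (l - 1 - i)).natDegree ≤ i * N + (l - 1 - i) * N :=
        add_le_add (natDegree_pow_le_of_le i le_rfl) (natDegree_pow_le_of_le _ hTN)
      _ = (l - 1) * N := by
        rw [← add_mul, Nat.add_sub_cancel' (Nat.le_sub_one_of_lt (Finset.mem_range.1 hi))]
  refine ⟨_, hDN, ?_⟩
  rw [hpow, coeff_add, hT0, add_zero, coeff_mul_add_eq_of_natDegree_le hle le_rfl,
    coeff_geom_sum₂ hN.ge hTN, ← hET, geom_sum₂_self, coeff_natDegree]
  exact mul_ne_zero (mul_ne_zero hl (pow_ne_zero _ (leadingCoeff_ne_zero.2 hE0)))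
    (leadingCoeff_ne_zero.2 hD)

theorem coeff_ne_zero_of_associated {R : Type*} [CommRing R] [IsDomain R] {f g : R[X]}
    (h : Associated f g) {n : ℕ} (hf : f.coeff n ≠ 0) : g.coeff n ≠ 0 := by
  obtain ⟨u, rfl⟩ := h
  obtain ⟨c, hc, hu⟩ := isUnit_iff.1 u.isUnit
  rw [← hu, coeff_mul_C]
  exact mul_ne_zero hf hc.ne_zero

theorem exists_associated_pow_of_mul_eq_mul_add_one {R : Type*} [CommRing R] [IsDomain R]
    [IsIntegrallyClosed R] {f g : R} (hf : f ≠ 0) (hg : g ≠ 0) {p q a b : ℕ} (hp : p ≠ 0)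
    (hab : p * a = q * b + 1) (h : Associated (g ^ p) (f ^ q)) :
    ∃ c : R, Associated f (c ^ p) ∧ Associated g (c ^ q) := by
  have hdvd : (g ^ b) ^ p ∣ (f ^ a) ^ p := by
    have h' : Associated ((g ^ b) ^ p) ((f ^ q) ^ b) := by
      rw [← pow_mul, mul_comm b p, pow_mul]
      exact h.pow_pow
    refine h'.dvd.trans ⟨f, ?_⟩
    rw [← pow_mul, ← pow_mul, ← pow_succ, mul_comm a p, hab]
  obtain ⟨c, hc⟩ : g ^ b ∣ f ^ a := (IsIntegrallyClosed.pow_dvd_pow_iff hp).1 hdvd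
  refine ⟨c, ?_, ?_⟩
  · have h' : Associated ((f ^ q) ^ b * f) ((f ^ q) ^ b * c ^ p) := by
      have hfc : (f ^ q) ^ b * f = (g ^ p) ^ b * c ^ p := by
        rw [← pow_mul, ← pow_succ, ← hab, mul_comm p a, pow_mul, hc]
        ring
      rw [hfc]
      exact h.pow_pow.mul_right _
    exact h'.of_mul_left (Associated.refl _) (pow_ne_zero _ (pow_ne_zero _ hf))
  · have h' : Associated ((g ^ q) ^ b * g) ((g ^ q) ^ b * c ^ q) := by
      have hfc : (f ^ q) ^ a = (g ^ q) ^ b * c ^ q := by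
        rw [← pow_mul, mul_comm q a, pow_mul, hc]
        ring
      have hgg : (g ^ p) ^ a = (g ^ q) ^ b * g := by
        rw [← pow_mul, ← pow_mul, hab, pow_succ]
      rw [← hfc, ← hgg]
      exact h.pow_pow
    exact h'.of_mul_left (Associated.refl _) (pow_ne_zero _ (pow_ne_zero _ hg))

end PolynomialPowers

section LeadingForms

open HahnSeries

/-- An exponential map on the `k`-algebra `A`, that is, a coaction of the additive group: its
coefficients form a locally finite iterative higher derivation. -/
structure IsExponential {k A : Type*} [CommSemiring k] [CommSemiring A] [Algebra k A]
    (φ : A →ₐ[k] A[X]) : Prop where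
  coeff_zero : ∀ a, (φ a).coeff 0 = a
  coeff_coeff : ∀ a i j, (φ ((φ a).coeff i)).coeff j = (i + j).choose i • (φ a).coeff (i + j)

variable {Γ k A : Type*} [AddCommGroup Γ] [LinearOrder Γ] [IsOrderedAddMonoid Γ] [Field k]
  [CommRing A] [Algebra k A]

/-- The homomorphism of Hahn series induced by a homomorphism of their coefficients. -/
noncomputable def hahnMap (Γ : Type*) [AddCommGroup Γ] [LinearOrder Γ] [IsOrderedAddMonoid Γ]
    {R R' : Type*} [CommSemiring R] [CommSemiring R'] [Algebra k R] [Algebra k R']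
    (f : R →ₐ[k] R') :
    HahnSeries Γ R →ₐ[k] HahnSeries Γ R' where
  toFun h := h.map f
  map_one' := HahnSeries.map_one (f : R →+* R').toMonoidWithZeroHom
  map_zero' := by ext; simp
  map_add' _ _ := by ext; simp
  map_mul' _ _ := HahnSeries.map_mul (f : R →+* R').toNonUnitalRingHom
  commutes' c := by
    ext γ
    simp only [HahnSeries.algebraMap_apply, HahnSeries.C_apply, HahnSeries.map_coeff,
      HahnSeries.coeff_single]
    split_ifs <;> simp

/-- The elements of `G` generate the algebra `A` in such a way that every element of `A` is a
combination of monomials in `G` without cancellation of leading terms. -/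
def IsKhovanskiiBasis (ι : A →ₐ[k] HahnSeries Γ k) (G : Set A) : Prop :=
  ∀ a, a ∈ Submodule.span k {m | m ∈ Submonoid.closure G ∧ (ι a).orderTop ≤ (ι m).orderTop}

/-- The homomorphism `a ↦ ∑ φᵢ(a) τ ^ (-i μ) X ^ i`, where `φᵢ(a)` is the coefficient of `X ^ i` in
`φ a` and `τ` is the variable of the Hahn series. -/
noncomputable def twist (ι : A →ₐ[k] HahnSeries Γ k) (φ : A →ₐ[k] A[X]) (μ : Γ) :
    A →ₐ[k] HahnSeries Γ k[X] :=
  (eval₂AlgHom ((hahnMap Γ CAlgHom).comp ι) (single (-μ) X) fun _ => Commute.all _ _).comp φ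

/-- The leading coefficient of the twist of `φ` by `μ`. When `μ` is the slope of `φ` this is the
effect of `φ` on the leading term of an element. -/
noncomputable def leadPoly (ι : A →ₐ[k] HahnSeries Γ k) (φ : A →ₐ[k] A[X]) (μ : Γ) : A →* k[X] where
  toFun a := (twist ι φ μ a).leadingCoeff
  map_one' := by rw [map_one, HahnSeries.leadingCoeff_one]
  map_mul' a b := by rw [map_mul, HahnSeries.leadingCoeff_mul]

/-- The slope of `φ` is the largest `μ` such that the `i`-th coefficient of `φ` raises orders by at
least `i • μ`. -/
structure IsSlope (ι : A →ₐ[k] HahnSeries Γ k) (φ : A →ₐ[k] A[X]) (μ : Γ) : Prop where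
  le_orderTop_coeff : ∀ a (i : ℕ),
    (ι a).orderTop + ((i • μ : Γ) : WithTop Γ) ≤ (ι ((φ a).coeff i)).orderTop
  exists_orderTop_coeff_eq : ∃ a, ∃ i : ℕ, 0 < i ∧ ∃ γ : Γ,
    (ι a).orderTop = γ ∧ (ι ((φ a).coeff i)).orderTop = (γ + i • μ : Γ)

variable {ι : A →ₐ[k] HahnSeries Γ k} {φ : A →ₐ[k] A[X]} {μ : Γ}

theorem coeff_coeff_twist (a : A) (γ : Γ) (i : ℕ) :
    ((twist ι φ μ a).coeff γ).coeff i = (ι ((φ a).coeff i)).coeff (γ + i • μ) := by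
  have h : twist ι φ μ a = ∑ n ∈ (φ a).support,
      hahnMap Γ (CAlgHom : k →ₐ[k] k[X]) (ι ((φ a).coeff n)) * single (n • (-μ)) (X ^ n) := by
    change eval₂ ((hahnMap Γ CAlgHom).comp ι).toRingHom (single (-μ) X) (φ a) = _
    rw [eval₂_eq_sum, sum_def]
    simp only [single_pow]
    rfl
  have hC (f : HahnSeries Γ k) (γ : Γ) :
      (hahnMap Γ (CAlgHom : k →ₐ[k] k[X]) f).coeff γ = Polynomial.C (f.coeff γ) := rfl
  rw [h, HahnSeries.coeff_sum, Polynomial.finsetSum_coeff]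
  simp only [coeff_mul_single, hC, coeff_C_mul, Polynomial.coeff_X_pow, mul_ite, mul_one, mul_zero]
  rw [Finset.sum_ite_eq]
  split_ifs with hi
  · rw [neg_nsmul, sub_neg_eq_add]
  · rw [notMem_support_iff.1 hi, map_zero, HahnSeries.coeff_zero]

theorem le_orderTop_twist_iff {a : A} :
    (ι a).orderTop ≤ (twist ι φ μ a).orderTop ↔
      ∀ i : ℕ, (ι a).orderTop + ((i • μ : Γ) : WithTop Γ) ≤ (ι ((φ a).coeff i)).orderTop := by
  constructor
  · intro h i
    rw [le_orderTop_iff_forall]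
    intro γ hγ
    rw [← sub_add_cancel γ (i • μ), ← coeff_coeff_twist, coeff_eq_zero_of_lt_orderTop,
      Polynomial.coeff_zero]
    refine lt_of_lt_of_le ?_ h
    rw [← sub_add_cancel γ (i • μ), WithTop.coe_add] at hγ
    exact lt_of_add_lt_add_right hγ
  · intro h
    rw [le_orderTop_iff_forall]
    intro γ hγ
    ext i
    rw [coeff_coeff_twist, Polynomial.coeff_zero]
    refine coeff_eq_zero_of_lt_orderTop (lt_of_lt_of_le ?_ (h i))
    rw [WithTop.coe_add]
    exact WithTop.add_lt_add_right WithTop.coe_ne_top hγ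

namespace IsKhovanskiiBasis

variable {G : Set A}

theorem adjoin_eq_top (hG : IsKhovanskiiBasis ι G) : Algebra.adjoin k G = ⊤ := by
  rw [← Algebra.toSubmodule_eq_top, Algebra.adjoin_eq_span, eq_top_iff]
  exact fun a _ => Submodule.span_mono (fun _ hm => hm.1) (hG a)

theorem le_orderTop_twist (hG : IsKhovanskiiBasis ι G)
    (h : ∀ g ∈ G, (ι g).orderTop ≤ (twist ι φ μ g).orderTop) (a : A) :
    (ι a).orderTop ≤ (twist ι φ μ a).orderTop := by
  have hmon : ∀ m ∈ Submonoid.closure G, (ι m).orderTop ≤ (twist ι φ μ m).orderTop := by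
    intro m hm
    induction hm using Submonoid.closure_induction with
    | mem g hg => exact h g hg
    | one => simp
    | mul m n _ _ hm hn =>
      rw [map_mul, map_mul, orderTop_mul, orderTop_mul]
      exact add_le_add hm hn
  have h := hG a
  generalize (ι a).orderTop = o at h
  induction h using Submodule.span_induction with
  | mem m hm => exact hm.2.trans (hmon m hm.1)
  | zero => simp
  | add b c _ _ hb hc =>
    rw [map_add]
    exact (le_min hb hc).trans min_orderTop_le_orderTop_add
  | smul c b _ hb =>
    rw [map_smul]
    exact hb.trans (orderTop_le_orderTop_smul c _)

theorem exists_coeff_ne_zero (hG : IsKhovanskiiBasis ι G) (hφ : IsExponential φ)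
    (hne : ∃ a, φ a ≠ Polynomial.C a) : ∃ g ∈ G, ∃ i : ℕ, 0 < i ∧ (φ g).coeff i ≠ 0 := by
  by_contra! h
  obtain ⟨a, ha⟩ := hne
  refine ha (DFunLike.congr_fun (AlgHom.ext_of_adjoin_eq_top hG.adjoin_eq_top fun g hg => ?_ :
    φ = CAlgHom) a)
  ext (_ | i)
  · simp [hφ.coeff_zero]
  · simp [h g hg (i + 1) i.succ_pos]

theorem exists_isSlope [Module ℚ Γ] (hι : Function.Injective ι) (hfin : G.Finite)
    (hG : IsKhovanskiiBasis ι G) (hφ : IsExponential φ) (hne : ∃ a, φ a ≠ Polynomial.C a) :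
    ∃ μ, IsSlope ι φ μ := by
  set T : Set (A × ℕ) := {p | p.1 ∈ G ∧ 0 < p.2 ∧ (φ p.1).coeff p.2 ≠ 0}
  have hTfin : T.Finite := by
    refine (hfin.biUnion fun g _ => (φ g).support.finite_toSet.image (Prod.mk g)).subset ?_
    rintro ⟨g, i⟩ ⟨hg, -, hi⟩
    exact Set.mem_biUnion hg ⟨i, mem_support_iff.2 hi, rfl⟩
  obtain ⟨g, hg, i, hi, hgi⟩ := hG.exists_coeff_ne_zero hφ hne
  let slope (p : A × ℕ) : Γ := (p.2 : ℚ)⁻¹ • ((ι ((φ p.1).coeff p.2)).order - (ι p.1).order)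
  obtain ⟨⟨g₀, i₀⟩, ⟨-, hi₀, hgi₀⟩, hmin⟩ :=
    T.exists_min_image slope hTfin ⟨(g, i), hg, hi, hgi⟩
  have hsmul {i : ℕ} (hi : 0 < i) (γ : Γ) : i • ((i : ℚ)⁻¹ • γ) = γ := by
    rw [← Nat.cast_smul_eq_nsmul ℚ, smul_inv_smul₀ (Nat.cast_ne_zero.2 hi.ne')]
  have hord {a : A} (ha : a ≠ 0) : (ι a).orderTop = (ι a).order :=
    (order_eq_orderTop_of_ne_zero ((map_ne_zero_iff ι hι).2 ha)).symm
  have hne_zero {g : A} {i : ℕ} (h : (φ g).coeff i ≠ 0) : g ≠ 0 := by rintro rfl; simp at h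
  refine ⟨slope (g₀, i₀), fun a =>
    le_orderTop_twist_iff.1 (hG.le_orderTop_twist (fun g hg => ?_) a),
    g₀, i₀, hi₀, _, hord (hne_zero hgi₀), ?_⟩
  · refine le_orderTop_twist_iff.2 fun i => ?_
    rcases Nat.eq_zero_or_pos i with rfl | hi
    · simp [hφ.coeff_zero]
    by_cases hc : (φ g).coeff i = 0
    · simp [hc]
    have h := nsmul_le_nsmul_right (hmin (g, i) ⟨hg, hi, hc⟩) i
    rw [hsmul hi] at h
    rw [hord (hne_zero hc), hord hc, ← WithTop.coe_add, WithTop.coe_le_coe]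
    exact le_sub_iff_add_le'.1 h
  · rw [hsmul hi₀, hord hgi₀, add_sub_cancel]

end IsKhovanskiiBasis

namespace IsSlope

theorem orderTop_twist (h : IsSlope ι φ μ) (hφ : IsExponential φ) {a : A} {γ : Γ}
    (ha : (ι a).orderTop = γ) : (twist ι φ μ a).orderTop = γ := by
  refine le_antisymm (orderTop_le_of_coeff_ne_zero fun h0 => coeff_orderTop_ne ha ?_) ?_
  · simpa [h0, hφ.coeff_zero] using (coeff_coeff_twist (ι := ι) (φ := φ) (μ := μ) a γ 0).symm
  · exact ha ▸ le_orderTop_twist_iff.2 (h.le_orderTop_coeff a)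

theorem leadPoly_eq_coeff (h : IsSlope ι φ μ) (hφ : IsExponential φ) {a : A} {γ : Γ}
    (ha : (ι a).orderTop = γ) : leadPoly ι φ μ a = (twist ι φ μ a).coeff γ := by
  have htw := h.orderTop_twist hφ ha
  have hne : twist ι φ μ a ≠ 0 := orderTop_ne_top.1 (htw ▸ WithTop.coe_ne_top)
  rw [← order_eq_orderTop_of_ne_zero hne, WithTop.coe_inj] at htw
  rw [← htw]
  exact leadingCoeff_eq

theorem coeff_leadPoly (h : IsSlope ι φ μ) (hφ : IsExponential φ) {a : A} {γ : Γ}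
    (ha : (ι a).orderTop = γ) (i : ℕ) :
    (leadPoly ι φ μ a).coeff i = (ι ((φ a).coeff i)).coeff (γ + i • μ) := by
  rw [h.leadPoly_eq_coeff hφ ha, coeff_coeff_twist]

theorem coeff_zero_leadPoly_ne_zero (h : IsSlope ι φ μ) (hφ : IsExponential φ) {a : A} {γ : Γ}
    (ha : (ι a).orderTop = γ) : (leadPoly ι φ μ a).coeff 0 ≠ 0 := by
  rw [h.coeff_leadPoly hφ ha, hφ.coeff_zero, zero_smul, add_zero]
  exact coeff_orderTop_ne ha

theorem leadPoly_ne_zero (h : IsSlope ι φ μ) (hφ : IsExponential φ) {a : A} {γ : Γ}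
    (ha : (ι a).orderTop = γ) : leadPoly ι φ μ a ≠ 0 :=
  fun h0 => h.coeff_zero_leadPoly_ne_zero hφ ha (by rw [h0, Polynomial.coeff_zero])

theorem orderTop_coeff (h : IsSlope ι φ μ) (hφ : IsExponential φ) {a : A} {γ : Γ}
    (ha : (ι a).orderTop = γ) {i : ℕ} (hi : (leadPoly ι φ μ a).coeff i ≠ 0) :
    (ι ((φ a).coeff i)).orderTop = (γ + i • μ : Γ) := by
  rw [h.coeff_leadPoly hφ ha] at hi
  refine le_antisymm (orderTop_le_of_coeff_ne_zero hi) ?_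
  rw [WithTop.coe_add, ← ha]
  exact h.le_orderTop_coeff a i

theorem orderTop_coeff_natDegree (h : IsSlope ι φ μ) (hφ : IsExponential φ) {a : A} {γ : Γ}
    (ha : (ι a).orderTop = γ) :
    (ι ((φ a).coeff (leadPoly ι φ μ a).natDegree)).orderTop =
      (γ + (leadPoly ι φ μ a).natDegree • μ : Γ) :=
  h.orderTop_coeff hφ ha (Polynomial.leadingCoeff_ne_zero.2 (h.leadPoly_ne_zero hφ ha))

theorem associated_leadPoly (h : IsSlope ι φ μ) (hφ : IsExponential φ) {a b : A} {γ : Γ}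
    (ha : (ι a).orderTop = γ) (hb : (ι b).orderTop = γ) :
    Associated (leadPoly ι φ μ a) (leadPoly ι φ μ b) := by
  have hcoeff : (twist ι φ μ ((ι b).coeff γ • a - (ι a).coeff γ • b)).coeff γ = 0 := by
    refine coeff_eq_zero_of_lt_orderTop
      (lt_of_lt_of_le ?_ (le_orderTop_twist_iff.2 (h.le_orderTop_coeff _)))
    rw [map_sub, map_smul, map_smul]
    exact lt_orderTop_smul_sub_smul ha hb
  have heq : (ι b).coeff γ • leadPoly ι φ μ a = (ι a).coeff γ • leadPoly ι φ μ b := by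
    rw [h.leadPoly_eq_coeff hφ ha, h.leadPoly_eq_coeff hφ hb]
    simpa [sub_eq_zero] using hcoeff
  have hsmul {c : k} (hc : c ≠ 0) (p : k[X]) : Associated p (c • p) := by
    rw [smul_eq_C_mul]
    exact (associated_unit_mul_left _ _ (isUnit_C.2 hc.isUnit)).symm
  exact (hsmul (coeff_orderTop_ne hb) _).trans (heq ▸ (hsmul (coeff_orderTop_ne ha) _).symm)

theorem natDegree_leadPoly_eq_zero (h : IsSlope ι φ μ) (hφ : IsExponential φ) {a : A} {γ : Γ}
    (ha : (ι a).orderTop = γ) (hinv : φ a = Polynomial.C a) : (leadPoly ι φ μ a).natDegree = 0 := by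
  rw [natDegree_eq_zero_iff_degree_le_zero, degree_le_iff_coeff_zero]
  intro j hj
  have hj : j ≠ 0 := by rintro rfl; simp at hj
  rw [h.coeff_leadPoly hφ ha, hinv, coeff_C_of_ne_zero hj, map_zero, HahnSeries.coeff_zero]

theorem natDegree_leadPoly_coeff_natDegree (h : IsSlope ι φ μ) (hφ : IsExponential φ) {a : A}
    {γ : Γ} (ha : (ι a).orderTop = γ) :
    (leadPoly ι φ μ ((φ a).coeff (leadPoly ι φ μ a).natDegree)).natDegree = 0 := by
  rw [natDegree_eq_zero_iff_degree_le_zero, degree_le_iff_coeff_zero]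
  intro j hj
  have hj : 0 < j := by exact_mod_cast hj
  have hzero := h.coeff_leadPoly hφ ha ((leadPoly ι φ μ a).natDegree + j)
  rw [coeff_eq_zero_of_natDegree_lt (by omega)] at hzero
  rw [h.coeff_leadPoly hφ (h.orderTop_coeff_natDegree hφ ha), hφ.coeff_coeff, add_assoc,
    ← add_nsmul, map_nsmul, HahnSeries.coeff_nsmul, Pi.smul_apply, ← hzero, smul_zero]

theorem exists_natDegree_leadPoly_pos (h : IsSlope ι φ μ) (hφ : IsExponential φ) :
    ∃ a, ∃ γ : Γ, (ι a).orderTop = γ ∧ 0 < (leadPoly ι φ μ a).natDegree := by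
  obtain ⟨a, i, hi, γ, ha, hc⟩ := h.exists_orderTop_coeff_eq
  refine ⟨a, γ, ha, hi.trans_le (le_natDegree_of_ne_zero ?_)⟩
  rw [h.coeff_leadPoly hφ ha]
  exact coeff_orderTop_ne hc

end IsSlope

end LeadingForms

/-! ### Invariants are polynomials in `x` -/

namespace DoubleDanielewski

open HahnSeries

variable {k : Type*} [Field k] (S : DoubleDanielewski k)

/-- The linear form on weights that vanishes on the weight `(-r s, -(d s + e))` of `t`, normalised
to take natural values at the weights of `x`, `z` and `y`. -/
noncomputable def weightForm : ℚ ×ₗ ℚ →+ ℚ where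
  toFun γ := S.r * S.s * (ofLex γ).2 - (S.d * S.s + S.e) * (ofLex γ).1
  map_zero' := by simp
  map_add' γ γ' := by
    simp only [ofLex_add, Prod.fst_add, Prod.snd_add]
    ring

theorem weightForm_lexPair (u v : ℚ) :
    S.weightForm (lexPair u v) = S.r * S.s * v - (S.d * S.s + S.e) * u := rfl

theorem weightForm_lexWeight (n : ℕ × ℕ × ℕ × ℕ) :
    S.weightForm (S.lexWeight n) =
      (S.r * S.s * n.1 + (S.d * S.s + S.e) * n.2.1 + S.r * S.e * n.2.2.1 : ℕ) := by
  rw [lexWeight, weightForm_lexPair]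
  push_cast
  ring

theorem add_add_ne_one (hr : 2 ≤ S.r) (hs : 0 < S.s) (l i j : ℕ) :
    S.r * S.s * l + (S.d * S.s + S.e) * i + S.r * S.e * j ≠ 1 := by
  intro h
  rcases Nat.eq_zero_or_pos i with rfl | hi
  · have := Nat.eq_one_of_mul_eq_one_right (show S.r * (S.s * l + S.e * j) = 1 by rw [← h]; ring)
    omega
  · have h₁ := Nat.mul_pos S.d_pos hs
    have h₂ := S.e_pos
    have h₃ := Nat.le_mul_of_pos_right (S.d * S.s + S.e) hi
    omega

namespace LexModel

variable {S}

theorem r_pos_and_s_pos (M : S.LexModel) : 0 < S.r ∧ 0 < S.s := by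
  have : Nontrivial S.B := M.toHahn.toRingHom.domain_nontrivial
  obtain ⟨n, hn, -⟩ := M.exists_orderTop_eq_and_mem_span one_ne_zero
  exact ⟨Nat.zero_lt_of_lt hn.1, Nat.zero_lt_of_lt hn.2⟩

variable (M : S.LexModel)

theorem orderTop_stripMonomial (n : ℕ × ℕ × ℕ × ℕ) :
    (M.toHahn (stripMonomial S.x S.y S.z M.t n)).orderTop = S.lexWeight n :=
  DoubleDanielewski.orderTop_stripMonomial M.toHahn_x M.toHahn_z M.orderTop_y M.orderTop_t n

theorem isKhovanskiiBasis : IsKhovanskiiBasis M.toHahn {S.x, S.y, S.z, M.t} := by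
  intro a
  by_cases ha : a = 0
  · exact ha ▸ Submodule.zero_mem _
  obtain ⟨n, -, ho, hmem⟩ := M.exists_orderTop_eq_and_mem_span ha
  refine Submodule.span_mono ?_ hmem
  rintro _ ⟨m, ⟨-, hle⟩, rfl⟩
  refine ⟨?_, by rwa [ho, M.orderTop_stripMonomial, WithTop.coe_le_coe]⟩
  have hgen {g : S.B} (hg : g ∈ ({S.x, S.y, S.z, M.t} : Set S.B)) (i : ℕ) :
      g ^ i ∈ Submonoid.closure {S.x, S.y, S.z, M.t} :=
    pow_mem (Submonoid.subset_closure hg) i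
  exact mul_mem (mul_mem (mul_mem (hgen (by simp) _) (hgen (by simp) _)) (hgen (by simp) _))
    (hgen (by simp) _)

theorem exists_eq_aeval_x {a : S.B}
    (ha : ∀ v : ℚ, (lexPair (-1) v : WithTop (ℚ ×ₗ ℚ)) < (M.toHahn a).orderTop) :
    ∃ p : k[X], a = aeval S.x p := by
  obtain ⟨f, hf, rfl⟩ := M.exists_eq_evalXZ (n := 1) M.r_pos_and_s_pos.1 (by simpa using ha)
  refine ⟨f.coeff 0, ?_⟩
  rw [← evalXZ_C S.x S.z, ← eq_C_of_degree_le_zero (Nat.WithBot.lt_one_iff_le_zero.1 hf)]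

variable {M} {φ : S.B →ₐ[k] S.B[X]} {μ : ℚ ×ₗ ℚ}

theorem natDegree_leadPoly_stripMonomial (h : IsSlope M.toHahn φ μ) (hφ : IsExponential φ)
    (n : ℕ × ℕ × ℕ × ℕ) :
    (leadPoly M.toHahn φ μ (stripMonomial S.x S.y S.z M.t n)).natDegree =
      n.1 * (leadPoly M.toHahn φ μ S.x).natDegree + n.2.1 * (leadPoly M.toHahn φ μ S.z).natDegree +
      n.2.2.1 * (leadPoly M.toHahn φ μ S.y).natDegree +
      n.2.2.2 * (leadPoly M.toHahn φ μ M.t).natDegree := by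
  have hx := h.leadPoly_ne_zero hφ M.orderTop_x
  have hy := h.leadPoly_ne_zero hφ M.orderTop_y
  have hz := h.leadPoly_ne_zero hφ M.orderTop_z
  have ht := h.leadPoly_ne_zero hφ M.orderTop_t
  simp only [stripMonomial, map_mul, map_pow]
  rw [natDegree_mul (by positivity) (by positivity), natDegree_mul (by positivity) (by positivity),
    natDegree_mul (by positivity) (by positivity)]
  simp only [natDegree_pow]

theorem natDegree_leadPoly_of_orderTop_eq (h : IsSlope M.toHahn φ μ) (hφ : IsExponential φ)
    {a : S.B} {n : ℕ × ℕ × ℕ × ℕ} (ha : (M.toHahn a).orderTop = S.lexWeight n) :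
    (leadPoly M.toHahn φ μ a).natDegree =
      n.1 * (leadPoly M.toHahn φ μ S.x).natDegree + n.2.1 * (leadPoly M.toHahn φ μ S.z).natDegree +
      n.2.2.1 * (leadPoly M.toHahn φ μ S.y).natDegree +
      n.2.2.2 * (leadPoly M.toHahn φ μ M.t).natDegree := by
  rw [← natDegree_leadPoly_stripMonomial h hφ]
  exact natDegree_eq_of_degree_eq
    (degree_eq_degree_of_associated (h.associated_leadPoly hφ ha (M.orderTop_stripMonomial n)))

theorem r_mul_natDegree_leadPoly_z (h : IsSlope M.toHahn φ μ) (hφ : IsExponential φ) :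
    S.r * (leadPoly M.toHahn φ μ S.z).natDegree =
      S.d * (leadPoly M.toHahn φ μ S.x).natDegree + (leadPoly M.toHahn φ μ S.y).natDegree := by
  have hz : (M.toHahn (S.z ^ S.r)).orderTop = S.lexWeight (S.d, 0, 1, 0) := by
    rw [map_pow, orderTop_pow_of_eq M.orderTop_z, nsmul_lexPair, lexWeight]
    simp
  simpa using natDegree_leadPoly_of_orderTop_eq h hφ hz

theorem s_mul_natDegree_leadPoly_y (h : IsSlope M.toHahn φ μ) (hφ : IsExponential φ) :
    S.s * (leadPoly M.toHahn φ μ S.y).natDegree =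
      S.e * (leadPoly M.toHahn φ μ S.x).natDegree + (leadPoly M.toHahn φ μ M.t).natDegree := by
  have hy : (M.toHahn (S.y ^ S.s)).orderTop = S.lexWeight (S.e, 0, 0, 1) := by
    rw [map_pow, orderTop_pow_of_eq M.orderTop_y, nsmul_lexPair, lexWeight]
    congr 2 <;> push_cast <;> ring
  simpa using natDegree_leadPoly_of_orderTop_eq h hφ hy

/-- The slope `μ` of `φ` is *vertical* when the leading term of `t` is invariant; this is the case
to be excluded when an invariant is not a polynomial in `x`. -/
structure IsVertical (M : S.LexModel) (φ : S.B →ₐ[k] S.B[X]) (μ : ℚ ×ₗ ℚ) : Prop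
    extends IsSlope M.toHahn φ μ, IsExponential φ where
  natDegree_leadPoly_t : (leadPoly M.toHahn φ μ M.t).natDegree = 0

theorem natDegree_leadPoly_t_eq_zero (h : IsSlope M.toHahn φ μ) (hφ : IsExponential φ) {f : S.B}
    (hf : φ f = Polynomial.C f) (hfx : ∀ p : k[X], f ≠ aeval S.x p) :
    (leadPoly M.toHahn φ μ M.t).natDegree = 0 := by
  have hf0 : f ≠ 0 := by simpa using hfx 0
  obtain ⟨⟨l, i, j, m⟩, -, ho, -⟩ := M.exists_orderTop_eq_and_mem_span hf0
  have hdeg := natDegree_leadPoly_of_orderTop_eq h hφ ho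
  rw [h.natDegree_leadPoly_eq_zero hφ ho hf] at hdeg
  have hz := r_mul_natDegree_leadPoly_z h hφ
  have hy := s_mul_natDegree_leadPoly_y h hφ
  rcases Nat.eq_zero_or_pos m with rfl | hm
  · rcases Nat.eq_zero_or_pos j with rfl | hj
    · rcases Nat.eq_zero_or_pos i with rfl | hi
      · obtain ⟨p, hp⟩ := M.exists_eq_aeval_x (a := f) fun v => by
          rw [ho, WithTop.coe_lt_coe, lexWeight, lexPair_lt_lexPair]
          simp
        exact absurd hp (hfx p)
      · have hz0 : (leadPoly M.toHahn φ μ S.z).natDegree = 0 :=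
          (Nat.mul_eq_zero.1 (by dsimp only at hdeg; omega)).resolve_left hi.ne'
        rw [hz0, mul_zero] at hz
        rw [show (leadPoly M.toHahn φ μ S.y).natDegree = 0 by omega, mul_zero] at hy
        omega
    · have hy0 : (leadPoly M.toHahn φ μ S.y).natDegree = 0 :=
        (Nat.mul_eq_zero.1 (by dsimp only at hdeg; omega)).resolve_left hj.ne'
      rw [hy0, mul_zero] at hy
      omega
  · exact (Nat.mul_eq_zero.1 (by dsimp only at hdeg; omega)).resolve_left hm.ne'

namespace IsVertical

theorem natDegree_leadPoly_x_pos (h : M.IsVertical φ μ) :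
    0 < (leadPoly M.toHahn φ μ S.x).natDegree := by
  obtain ⟨hr, hs⟩ := M.r_pos_and_s_pos
  obtain ⟨a, γ, ha, hpos⟩ := h.exists_natDegree_leadPoly_pos h.toIsExponential
  have ha0 : a ≠ 0 := by rintro rfl; simp at ha
  obtain ⟨n, -, hn, -⟩ := M.exists_orderTop_eq_and_mem_span ha0
  have hz := r_mul_natDegree_leadPoly_z h.toIsSlope h.toIsExponential
  have hy := s_mul_natDegree_leadPoly_y h.toIsSlope h.toIsExponential
  refine Nat.pos_of_ne_zero fun hx0 => hpos.ne' ?_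
  rw [h.natDegree_leadPoly_t, hx0, mul_zero, zero_add, Nat.mul_eq_zero] at hy
  have hy0 := hy.resolve_left hs.ne'
  rw [hx0, hy0, mul_zero, zero_add, Nat.mul_eq_zero] at hz
  rw [natDegree_leadPoly_of_orderTop_eq h.toIsSlope h.toIsExponential hn, hx0, hy0,
    hz.resolve_left hr.ne', h.natDegree_leadPoly_t]
  simp

theorem natDegree_leadPoly_y_pos (h : M.IsVertical φ μ) :
    0 < (leadPoly M.toHahn φ μ S.y).natDegree := by
  have hy := s_mul_natDegree_leadPoly_y h.toIsSlope h.toIsExponential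
  refine Nat.pos_of_ne_zero fun h0 => (Nat.mul_pos S.e_pos h.natDegree_leadPoly_x_pos).ne' ?_
  rw [h0, mul_zero] at hy
  omega

theorem natDegree_leadPoly_z_pos (h : M.IsVertical φ μ) :
    0 < (leadPoly M.toHahn φ μ S.z).natDegree := by
  have hz := r_mul_natDegree_leadPoly_z h.toIsSlope h.toIsExponential
  refine Nat.pos_of_ne_zero fun h0 => h.natDegree_leadPoly_y_pos.ne' ?_
  rw [h0, mul_zero] at hz
  omega

theorem exists_add_nsmul_eq_lexWeight (h : M.IsVertical φ μ) {a : S.B} {γ : ℚ ×ₗ ℚ}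
    (ha : (M.toHahn a).orderTop = γ) :
    ∃ m : ℕ, γ + (leadPoly M.toHahn φ μ a).natDegree • μ = S.lexWeight (0, 0, 0, m) := by
  have hc := h.orderTop_coeff_natDegree h.toIsExponential ha
  have hinv := h.natDegree_leadPoly_coeff_natDegree h.toIsExponential ha
  generalize (φ a).coeff (leadPoly M.toHahn φ μ a).natDegree = b at hc hinv
  have hb0 : b ≠ 0 := by
    rintro rfl
    exact WithTop.top_ne_coe (by simpa only [map_zero, orderTop_zero] using hc)
  obtain ⟨⟨l, i, j, m⟩, -, ho, -⟩ := M.exists_orderTop_eq_and_mem_span hb0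
  have hdeg := natDegree_leadPoly_of_orderTop_eq h.toIsSlope h.toIsExponential ho
  rw [hinv] at hdeg
  dsimp only at hdeg
  obtain rfl : l = 0 := (Nat.mul_eq_zero.1 (by omega)).resolve_right h.natDegree_leadPoly_x_pos.ne'
  obtain rfl : i = 0 := (Nat.mul_eq_zero.1 (by omega)).resolve_right h.natDegree_leadPoly_z_pos.ne'
  obtain rfl : j = 0 := (Nat.mul_eq_zero.1 (by omega)).resolve_right h.natDegree_leadPoly_y_pos.ne'
  exact ⟨m, WithTop.coe_inj.1 (hc.symm.trans ho)⟩

theorem natDegree_leadPoly_mul_weightForm (h : M.IsVertical φ μ) {a : S.B} {γ : ℚ ×ₗ ℚ}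
    (ha : (M.toHahn a).orderTop = γ) :
    (leadPoly M.toHahn φ μ a).natDegree * S.weightForm μ = -S.weightForm γ := by
  obtain ⟨m, hm⟩ := h.exists_add_nsmul_eq_lexWeight ha
  have hform := congrArg S.weightForm hm
  rw [map_add, map_nsmul, weightForm_lexWeight, nsmul_eq_mul] at hform
  simp only [mul_zero, add_zero, Nat.cast_zero] at hform
  linarith

theorem natDegree_leadPoly_x_mul_weightForm (h : M.IsVertical φ μ) :
    (leadPoly M.toHahn φ μ S.x).natDegree * S.weightForm μ = -(S.r * S.s) := by
  rw [h.natDegree_leadPoly_mul_weightForm M.orderTop_x, weightForm_lexPair]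
  ring

theorem natDegree_leadPoly_z_mul_weightForm (h : M.IsVertical φ μ) :
    (leadPoly M.toHahn φ μ S.z).natDegree * S.weightForm μ = -(S.d * S.s + S.e) := by
  rw [h.natDegree_leadPoly_mul_weightForm M.orderTop_z, weightForm_lexPair]
  ring

theorem weightForm_ne_zero (h : M.IsVertical φ μ) : S.weightForm μ ≠ 0 := by
  obtain ⟨hr, hs⟩ := M.r_pos_and_s_pos
  have hx := h.natDegree_leadPoly_x_mul_weightForm
  intro h0
  rw [h0, mul_zero, eq_comm, neg_eq_zero] at hx
  exact (by positivity : (S.r * S.s : ℚ) ≠ 0) hx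

theorem mul_natDegree_leadPoly_z (h : M.IsVertical φ μ) :
    S.r * S.s * (leadPoly M.toHahn φ μ S.z).natDegree =
      (S.d * S.s + S.e) * (leadPoly M.toHahn φ μ S.x).natDegree := by
  have hx := h.natDegree_leadPoly_x_mul_weightForm
  have hz := h.natDegree_leadPoly_z_mul_weightForm
  have : (S.r * S.s * (leadPoly M.toHahn φ μ S.z).natDegree : ℚ) =
      (S.d * S.s + S.e) * (leadPoly M.toHahn φ μ S.x).natDegree := by
    refine mul_right_cancel₀ h.weightForm_ne_zero ?_
    linear_combination (S.r * S.s : ℚ) * hz - (S.d * S.s + S.e : ℚ) * hx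
  exact_mod_cast this

theorem exists_bezout (h : M.IsVertical φ μ) :
    ∃ a b : ℕ, S.r * S.s * a = (S.d * S.s + S.e) * b + 1 := by
  obtain ⟨b, hb⟩ := h.exists_add_nsmul_eq_lexWeight M.orderTop_x
  obtain ⟨a, ha⟩ := h.exists_add_nsmul_eq_lexWeight M.orderTop_z
  obtain ⟨hr, hs⟩ := M.r_pos_and_s_pos
  obtain ⟨μ₁, μ₂, rfl⟩ : ∃ u v, μ = lexPair u v := ⟨(ofLex μ).1, (ofLex μ).2, rfl⟩
  rw [nsmul_lexPair, lexPair_add, lexWeight, lexPair_inj] at ha hb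
  have hrel : (S.r * S.s * (leadPoly M.toHahn φ (lexPair μ₁ μ₂) S.z).natDegree : ℚ) =
      (S.d * S.s + S.e) * (leadPoly M.toHahn φ (lexPair μ₁ μ₂) S.x).natDegree := by
    exact_mod_cast h.mul_natDegree_leadPoly_z
  have hpos : (S.r * S.s : ℚ) ≠ 0 := by positivity
  have hab : (S.r * S.s * a : ℚ) = (S.d * S.s + S.e) * b + 1 := by
    refine mul_left_cancel₀ hpos ?_
    have ha := ha.1
    have hb := hb.1
    simp only [Nat.cast_zero, mul_zero, zero_add] at ha hb
    linear_combination (S.r * S.s : ℚ) * ha - (S.d * S.s + S.e : ℚ) * hb - μ₁ * hrel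
  exact ⟨a, b, by exact_mod_cast hab⟩

theorem exists_natDegree_leadPoly_eq_mul (h : M.IsVertical φ μ) :
    ∃ N : ℕ, 0 < N ∧ (leadPoly M.toHahn φ μ S.x).natDegree = S.r * S.s * N ∧
      N * S.weightForm μ = -1 := by
  obtain ⟨a, b, hab⟩ := h.exists_bezout
  obtain ⟨hr, hs⟩ := M.r_pos_and_s_pos
  have hcop : (S.r * S.s).Coprime (S.d * S.s + S.e) := by
    rw [Nat.coprime_iff_gcd_eq_one, ← Nat.dvd_one,
      ← Nat.dvd_add_right ((Nat.gcd_dvd_right _ _).mul_right b), ← hab]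
    exact (Nat.gcd_dvd_left _ _).mul_right a
  obtain ⟨N, hN⟩ := hcop.dvd_of_dvd_mul_left ⟨_, h.mul_natDegree_leadPoly_z.symm⟩
  have hx := h.natDegree_leadPoly_x_mul_weightForm
  refine ⟨N, Nat.pos_of_mul_pos_left (hN ▸ h.natDegree_leadPoly_x_pos), hN, ?_⟩
  have hpos : (S.r * S.s : ℚ) ≠ 0 := by positivity
  refine mul_left_cancel₀ hpos ?_
  rw [hN] at hx
  push_cast at hx
  linear_combination hx

theorem exists_associated_leadPoly (h : M.IsVertical φ μ) :
    ∃ E : k[X], Associated (leadPoly M.toHahn φ μ S.x) (E ^ (S.r * S.s)) ∧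
      Associated (leadPoly M.toHahn φ μ S.z) (E ^ (S.d * S.s + S.e)) := by
  obtain ⟨a, b, hab⟩ := h.exists_bezout
  obtain ⟨hr, hs⟩ := M.r_pos_and_s_pos
  refine exists_associated_pow_of_mul_eq_mul_add_one
    (h.leadPoly_ne_zero h.toIsExponential M.orderTop_x)
    (h.leadPoly_ne_zero h.toIsExponential M.orderTop_z) (Nat.mul_pos hr hs).ne' hab ?_
  have hz : (M.toHahn (S.z ^ (S.r * S.s))).orderTop = S.lexWeight (S.d * S.s + S.e, 0, 0, 1) := by
    rw [map_pow, orderTop_pow_of_eq M.orderTop_z, nsmul_lexPair, lexWeight]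
    congr 2 <;> push_cast <;> ring
  have hassoc := h.associated_leadPoly h.toIsExponential hz (M.orderTop_stripMonomial _)
  simp only [stripMonomial, map_mul, map_pow, pow_zero, mul_one, pow_one] at hassoc
  refine hassoc.trans (associated_mul_unit_left _ _ ?_)
  rw [isUnit_iff_degree_eq_zero,
    degree_eq_natDegree (h.leadPoly_ne_zero h.toIsExponential M.orderTop_t),
    h.natDegree_leadPoly_t, Nat.cast_zero]

theorem exists_natDegree_eq_and_associated_leadPoly (h : M.IsVertical φ μ) :
    ∃ E : k[X], 0 < E.natDegree ∧ E.coeff 0 ≠ 0 ∧ E.natDegree * S.weightForm μ = -1 ∧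
      Associated (leadPoly M.toHahn φ μ S.x) (E ^ (S.r * S.s)) ∧
      Associated (leadPoly M.toHahn φ μ S.z) (E ^ (S.d * S.s + S.e)) := by
  obtain ⟨E, hEx, hEz⟩ := h.exists_associated_leadPoly
  obtain ⟨N, hN, hxN, hform⟩ := h.exists_natDegree_leadPoly_eq_mul
  obtain ⟨hr, hs⟩ := M.r_pos_and_s_pos
  have hEN : E.natDegree = N := by
    have hdeg := natDegree_eq_of_degree_eq (degree_eq_degree_of_associated hEx)
    rw [natDegree_pow, hxN] at hdeg
    exact (Nat.eq_of_mul_eq_mul_left (Nat.mul_pos hr hs) hdeg).symm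
  refine ⟨E, hEN ▸ hN, fun h0 => ?_, hEN ▸ hform, hEx, hEz⟩
  refine coeff_ne_zero_of_associated hEx
    (h.coeff_zero_leadPoly_ne_zero h.toIsExponential M.orderTop_x) ?_
  rw [coeff_zero_eq_eval_zero, eval_pow, ← coeff_zero_eq_eval_zero, h0,
    zero_pow (Nat.mul_pos hr hs).ne']

theorem cast_eq_zero_of_associated (hr : 2 ≤ S.r) (h : M.IsVertical φ μ) {E : k[X]}
    (hE : 0 < E.natDegree) (h0 : E.coeff 0 ≠ 0) (hform : E.natDegree * S.weightForm μ = -1)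
    {a : S.B} {γ : ℚ ×ₗ ℚ} (ha : (M.toHahn a).orderTop = γ) {l : ℕ} (hl : S.weightForm γ = l)
    (hass : Associated (leadPoly M.toHahn φ μ a) (E ^ l)) : (l : k) = 0 := by
  by_contra hlk
  obtain ⟨i, hi, hc⟩ := exists_coeff_pow_ne_zero hE h0 hlk
  have ho := h.orderTop_coeff h.toIsExponential ha (coeff_ne_zero_of_associated hass.symm hc)
  have hne : (φ a).coeff ((l - 1) * E.natDegree + i) ≠ 0 := by
    intro h0
    exact WithTop.top_ne_coe (by simpa only [h0, map_zero, orderTop_zero] using ho)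
  obtain ⟨⟨l', i', j', m'⟩, -, hn, -⟩ := M.exists_orderTop_eq_and_mem_span hne
  have hw := congrArg S.weightForm (WithTop.coe_inj.1 (ho.symm.trans hn))
  rw [map_add, map_nsmul, weightForm_lexWeight, nsmul_eq_mul, hl] at hw
  dsimp only at hw
  set n := S.r * S.s * l' + (S.d * S.s + S.e) * i' + S.r * S.e * j'
  have hl1 : 1 ≤ l := Nat.one_le_iff_ne_zero.2 (by rintro rfl; simp at hlk)
  have hsum : E.natDegree * n + i = E.natDegree := by
    have : (E.natDegree * n + i : ℚ) = E.natDegree := by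
      push_cast [Nat.cast_sub hl1] at hw
      linear_combination -(E.natDegree : ℚ) * hw + (((l : ℚ) - 1) * E.natDegree + i) * hform
    exact_mod_cast this
  have hn1 : n = 1 := by
    refine le_antisymm (Nat.le_of_mul_le_mul_left (by omega) hE) (Nat.pos_of_ne_zero fun hn0 => ?_)
    rw [hn0, mul_zero] at hsum
    omega
  exact S.add_add_ne_one hr M.r_pos_and_s_pos.2 l' i' j' hn1

theorem false (hr : 2 ≤ S.r) (h : M.IsVertical φ μ) : False := by
  obtain ⟨E, hE, h0, hform, hEx, hEz⟩ := h.exists_natDegree_eq_and_associated_leadPoly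
  have hp := h.cast_eq_zero_of_associated hr hE h0 hform M.orderTop_x
    (by rw [weightForm_lexPair]; push_cast; ring) hEx
  have hq := h.cast_eq_zero_of_associated hr hE h0 hform M.orderTop_z
    (by rw [weightForm_lexPair]; push_cast; ring) hEz
  obtain ⟨a, b, hab⟩ := h.exists_bezout
  simpa [hp, hq] using congrArg (Nat.cast (R := k)) hab

end IsVertical

theorem exists_eq_aeval_of_invariant (M : S.LexModel) (hr : 2 ≤ S.r) (hφ : IsExponential φ)
    (hne : ∃ a, φ a ≠ Polynomial.C a) {f : S.B} (hf : φ f = Polynomial.C f) :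
    ∃ p : k[X], f = aeval S.x p := by
  by_contra! hfx
  obtain ⟨μ, h⟩ := M.isKhovanskiiBasis.exists_isSlope M.toHahn_injective (Set.toFinite _) hφ hne
  exact IsVertical.false hr ⟨h, hφ, natDegree_leadPoly_t_eq_zero h hφ hf hfx⟩

end LexModel
end DoubleDanielewski

/-! ### A nontrivial exponential map -/

section Exponential

variable {k A : Type*} [Field k] [CommRing A] [Algebra k A]

variable (k A) in
/-- The homomorphism `U ↦ U + V` from `A[U]` to `A[U][V]`: the comultiplication of the additive
group, over `A`. -/
noncomputable def coaddHom : A[X] →ₐ[k] A[X][X] :=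
  eval₂AlgHom ((CAlgHom (R := k) (A := A[X])).comp CAlgHom) (X + C X) fun _ => Commute.all _ _

theorem coaddHom_C (a : A) : coaddHom k A (C a) = C (C a) :=
  eval₂_C _ _

theorem coaddHom_X : coaddHom k A X = X + C X :=
  eval₂_X _ _

theorem isExponential_of_comp_eq {φ : A →ₐ[k] A[X]}
    (h0 : ((aeval (R := A) (0 : A)).restrictScalars k).comp φ = AlgHom.id k A)
    (h : (mapAlgHom φ).comp φ = (coaddHom k A).comp φ) : IsExponential φ := by
  refine ⟨fun a => (coeff_zero_eq_aeval_zero _).trans (DFunLike.congr_fun h0 a), fun b i j => ?_⟩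
  have h : (φ b).map φ.toRingHom = (φ b).eval₂ (C.comp C) (X + C X) := DFunLike.congr_fun h b
  have h := congrArg (fun q => (q.coeff i).coeff j) h
  rw [eval₂_eq_sum, sum_def] at h
  simp only [Polynomial.coeff_map, RingHom.comp_apply, finsetSum_coeff, coeff_C_mul,
    coeff_X_add_C_pow] at h
  have hterm : ∀ n ∈ (φ b).support, (φ b).coeff n * ((X : A[X]) ^ (n - i) *
      ((n.choose i : ℕ) : A[X])).coeff j =
        if i + j = n then (i + j).choose i • (φ b).coeff (i + j) else 0 := by
    intro n _
    rw [mul_comm (X ^ _), ← nsmul_eq_mul, coeff_smul, coeff_X_pow]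
    split_ifs with hj hn hn
    · subst hn
      rw [nsmul_one, nsmul_eq_mul, mul_comm]
    · rw [Nat.choose_eq_zero_of_lt (by omega), zero_smul, mul_zero]
    · omega
    · rw [smul_zero, mul_zero]
  rw [Finset.sum_congr rfl hterm, Finset.sum_ite_eq] at h
  refine h.trans ?_
  split_ifs with hmem
  · rfl
  · rw [notMem_support_iff.1 hmem, smul_zero]

theorem isLeftRegular_C {R : Type*} [CommRing R] {a : R} (ha : IsLeftRegular a) :
    IsLeftRegular (C a : R[X]) := fun p q h => Polynomial.ext fun n => ha <| by
  simpa only [coeff_C_mul] using congrArg (fun f => f.coeff n) h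

theorem IsExponential.conj {A' : Type*} [CommRing A'] [Algebra k A'] {φ : A →ₐ[k] A[X]}
    (hφ : IsExponential φ) (ψ : A ≃ₐ[k] A') :
    IsExponential ((mapAlgHom ψ.toAlgHom).comp (φ.comp ψ.symm.toAlgHom)) := by
  have h : ∀ a i, ((mapAlgHom ψ.toAlgHom).comp (φ.comp ψ.symm.toAlgHom) a).coeff i =
      ψ ((φ (ψ.symm a)).coeff i) := fun a i => by simp
  refine ⟨fun a => ?_, fun a i j => ?_⟩
  · rw [h, hφ.coeff_zero, ψ.apply_symm_apply]
  · rw [h, h, h, ψ.symm_apply_apply, hφ.coeff_coeff, map_nsmul]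

end Exponential

section Divisibility

variable {k A : Type*} [CommRing k] [CommRing A] [Algebra k A]

theorem sub_dvd_evalXZ_sub (x z z' : A) (p : k[X][X]) :
    z' - z ∣ evalXZ x z' p - evalXZ x z p := by
  simpa only [eval_map, evalXZ] using
    sub_dvd_eval_sub z' z (p.map (aeval (R := k) x).toRingHom)

theorem dvd_evalXYZ_sub {x y y' z z' u : A} (hy : u ∣ y' - y) (hz : u ∣ z' - z) (q : k[X][X][X]) :
    u ∣ evalXYZ x y' z' q - evalXYZ x y z q := by
  rw [evalXYZ_eq_sum, evalXYZ_eq_sum, ← Finset.sum_sub_distrib]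
  refine Finset.dvd_sum fun j _ => ?_
  rw [show evalXZ x z' (q.coeff j) * y' ^ j - evalXZ x z (q.coeff j) * y ^ j =
    (evalXZ x z' (q.coeff j) - evalXZ x z (q.coeff j)) * y' ^ j +
      evalXZ x z (q.coeff j) * (y' ^ j - y ^ j) by ring]
  exact dvd_add ((hz.trans (sub_dvd_evalXZ_sub _ _ _ _)).mul_right _)
    ((hy.trans (sub_dvd_pow_sub_pow _ _ _)).mul_left _)

end Divisibility

namespace DoubleDanielewski

section Translation

variable {k A : Type*} [Field k] {S : DoubleDanielewski k} [CommRing A] [Algebra k A]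

theorem hom_ext {f g : S.B →ₐ[k] A} (hx : f S.x = g S.x) (hz : f S.z = g S.z)
    (hreg : IsLeftRegular (f S.x)) : f = g := by
  have hf := S.isPoint.map f
  have hg := S.isPoint.map g
  rw [← hx, ← hz] at hg
  have hy : f S.y = g S.y := hreg.pow S.d (hf.pow_d_mul.trans hg.pow_d_mul.symm)
  rw [← hy] at hg
  have ht : f S.t = g S.t := hreg.pow S.e (hf.pow_e_mul.trans hg.pow_e_mul.symm)
  refine AlgHom.ext_of_adjoin_eq_top S.adjoin_generators_eq_top ?_
  rintro _ (rfl | rfl | rfl | rfl) <;> assumption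

variable (S) in
theorem isLeftRegular_x : IsLeftRegular S.x := by
  rcases Nat.eq_zero_or_pos S.r with hr | hr
  · have h := S.isPoint.pow_d_mul
    rw [S.P_monic.natDegree_eq_zero.1 hr, ← C_1, evalXZ_C, map_one] at h
    exact ((isUnit_pow_iff S.d_pos.ne').1 (.of_mul_eq_one _ h)).isRegular.left
  rcases Nat.eq_zero_or_pos S.s with hs | hs
  · have h := S.isPoint.pow_e_mul
    rw [S.Q_monic.natDegree_eq_zero.1 hs, ← C_1, evalXYZ_C, ← C_1, evalXZ_C, map_one] at h
    exact ((isUnit_pow_iff S.e_pos.ne').1 (.of_mul_eq_one _ h)).isRegular.left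
  have := isDomain_B hr hs
  exact (IsRegular.of_ne_zero (x_ne_zero hr hs)).left

theorem IsPoint.exists_translate {x y z t : A} (h : S.IsPoint x y z t) :
    ∃ Y T : A[X], S.IsPoint (C x) Y (C z + C (x ^ (S.d + S.e)) * X) T := by
  set Z : A[X] := C z + C (x ^ (S.d + S.e)) * X with hZ
  have hC : S.IsPoint (C x) (C y) (C z) (C t) := h.map CAlgHom
  have hZ' : Z - C z = C x ^ S.d * (C x ^ S.e * X) := by
    rw [hZ, C_pow, pow_add]
    ring
  obtain ⟨p, hp⟩ := sub_dvd_evalXZ_sub (C x) (C z) Z S.P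
  obtain ⟨q, hq⟩ := dvd_evalXYZ_sub (x := C x) (y := C y) (y' := C y + C x ^ S.e * X * p)
    (z := C z) (z' := Z) (u := C x ^ S.e * X) ⟨p, by ring⟩ ⟨C x ^ S.d, by rw [hZ', mul_comm]⟩ S.Q
  rw [← hC.pow_d_mul, hZ'] at hp
  rw [← hC.pow_e_mul] at hq
  exact ⟨C y + C x ^ S.e * X * p, C t + X * q, by linear_combination -hp,
    by linear_combination -hq⟩

theorem isExponential_of_translation {φ : S.B →ₐ[k] S.B[X]} {n : ℕ} (hx : φ S.x = C S.x)
    (hz : φ S.z = C S.z + C (S.x ^ n) * X) : IsExponential φ := by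
  refine isExponential_of_comp_eq (hom_ext ?_ ?_ ?_) (hom_ext ?_ ?_ ?_)
  · simp [hx]
  · simp [hz]
  · simpa [hx] using S.isLeftRegular_x
  · simp [hx, coaddHom_C]
  · simp only [AlgHom.comp_apply, hz, map_add, map_mul, coaddHom_C, coaddHom_X]
    simp [hx, hz]
    ring
  · simpa [hx] using isLeftRegular_C (isLeftRegular_C S.isLeftRegular_x)

variable (S) in
theorem exists_isExponential : ∃ φ : S.B →ₐ[k] S.B[X], IsExponential φ ∧ φ S.x = C S.x ∧
    φ S.z = C S.z + C (S.x ^ (S.d + S.e)) * X := by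
  obtain ⟨Y, T, h⟩ := S.isPoint.exists_translate
  exact ⟨h.lift, isExponential_of_translation h.lift_x h.lift_z, h.lift_x, h.lift_z⟩

end Translation

end DoubleDanielewski

/-! ### Fibres over the `x`-line -/

section ConstantArgument

variable {k A : Type*} [CommRing k] [CommRing A] [Algebra k A]

theorem evalXZ_C_left (u : A) (w : A[X]) (p : k[X][X]) :
    evalXZ (C u) w p = (p.map (aeval u).toRingHom).comp w := by
  have h : (aeval (R := k) (C u)).toRingHom = C.comp (aeval (R := k) u).toRingHom := by
    ext <;> simp [Polynomial.algebraMap_apply]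
  rw [evalXZ, h, comp, eval₂_map]

theorem exists_eq_C_of_evalXZ_C_eq_zero {K F : Type*} [CommRing K] [CommRing F] [IsDomain F]
    [Algebra K F] {P : K[X][X]} (hP : P.Monic) (hr : P.natDegree ≠ 0) {u : F} {w : F[X]}
    (h : evalXZ (C u) w P = 0) : ∃ a, w = C a := by
  have hdeg := natDegree_comp (p := P.map (aeval u).toRingHom) (q := w)
  rw [← evalXZ_C_left, h, natDegree_zero, hP.natDegree_map] at hdeg
  exact natDegree_eq_zero.1 ((Nat.mul_eq_zero.1 hdeg.symm).resolve_left hr) |>.imp fun _ => Eq.symm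

end ConstantArgument

namespace DoubleDanielewski

section Localization

variable {k : Type*} [Field k] (S : DoubleDanielewski k)

/-- The subalgebra of those elements of the coordinate ring that become polynomials in `x` and `z`
after multiplication by a power of `x`. -/
noncomputable def denominatorSubalgebra : Subalgebra k S.B where
  carrier := {b | ∃ (n : ℕ) (p : k[X][X]), S.x ^ n * b = evalXZ S.x S.z p}
  mul_mem' := by
    rintro a b ⟨n, p, hp⟩ ⟨m, q, hq⟩
    exact ⟨n + m, p * q, by rw [evalXZ_mul, ← hp, ← hq]; ring⟩
  add_mem' := by
    rintro a b ⟨n, p, hp⟩ ⟨m, q, hq⟩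
    refine ⟨n + m, C X ^ m * p + C X ^ n * q, ?_⟩
    simp only [evalXZ_add, evalXZ_mul, evalXZ_pow, evalXZ_C, aeval_X, ← hp, ← hq]
    ring
  algebraMap_mem' c := ⟨0, C (C c), by simp⟩

theorem exists_pow_mul_eq_evalXZ (b : S.B) :
    ∃ (n : ℕ) (p : k[X][X]), S.x ^ n * b = evalXZ S.x S.z p := by
  have hx : S.x ∈ S.denominatorSubalgebra := ⟨0, C X, by simp⟩
  have hz : S.z ∈ S.denominatorSubalgebra := ⟨0, X, by simp⟩
  have hy : S.y ∈ S.denominatorSubalgebra := ⟨S.d, S.P, S.isPoint.pow_d_mul⟩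
  have ht : S.t ∈ S.denominatorSubalgebra := by
    obtain ⟨n, p, hp⟩ := evalXYZ_mem_subalgebra _ hx hy hz S.Q
    exact ⟨n + S.e, p, by rw [← hp, ← S.isPoint.pow_e_mul]; ring⟩
  have hle : Algebra.adjoin k {S.x, S.y, S.z, S.t} ≤ S.denominatorSubalgebra := by
    refine Algebra.adjoin_le ?_
    rintro _ (rfl | rfl | rfl | rfl) <;> assumption
  exact hle (S.adjoin_generators_eq_top ▸ Algebra.mem_top)

variable {S}

theorem exists_eq_evalXZ_of_pow_mul (hs : 0 < S.s) {n N : ℕ} (hN : N ≤ S.r) (hN0 : 0 < N)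
    {b : S.B} {p : k[X][X]} (hp : p.degree < N) (h : S.x ^ n * b = evalXZ S.x S.z p) :
    ∃ f : k[X][X], f.degree < N ∧ b = evalXZ S.x S.z f ∧ p = C X ^ n * f := by
  have hr : 0 < S.r := hN0.trans_le hN
  obtain ⟨M⟩ := nonempty_lexModel hr hs
  suffices hb : ∀ v : ℚ, (lexPair (-N) v : WithTop (ℚ ×ₗ ℚ)) < (M.toHahn b).orderTop by
    obtain ⟨f, hf, rfl⟩ := M.exists_eq_evalXZ hN hb
    exact ⟨f, hf, rfl, evalXZ_injective hr hs (by simp [← h])⟩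
  intro v
  rcases eq_or_ne p 0 with rfl | hp0
  · have hb : b = 0 := S.isLeftRegular_x.pow n (by simpa [← evalXZHom_apply] using h)
    simp [hb]
  have ho := congrArg (fun a => (M.toHahn a).orderTop) h
  simp only [map_mul, map_pow, HahnSeries.orderTop_mul, orderTop_pow_of_eq M.orderTop_x,
    M.orderTop_evalXZ hp0] at ho
  cases hb : (M.toHahn b).orderTop with
  | top => exact WithTop.coe_lt_top _
  | coe γ =>
    obtain ⟨u, w, rfl⟩ : ∃ u w, γ = lexPair u w := ⟨_, _, rfl⟩
    rw [hb, ← WithTop.coe_add, WithTop.coe_inj, nsmul_lexPair, lexPair_add, lexPair_inj] at ho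
    have hlt : (p.natDegree : ℚ) < N := by exact_mod_cast (natDegree_lt_iff_degree_lt hp0).2 hp
    rw [WithTop.coe_lt_coe, lexPair_lt_lexPair]
    left
    linarith [ho.1]

theorem not_x_dvd_z_sub (hr : 2 ≤ S.r) (hs : 0 < S.s) (a : k) :
    ¬ S.x ∣ S.z - algebraMap k S.B a := by
  rintro ⟨w, hw⟩
  obtain ⟨f, -, -, hf⟩ := exists_eq_evalXZ_of_pow_mul (n := 1) (b := w) (p := X - C (C a)) hs hr
    two_pos (by rw [degree_X_sub_C]; norm_num) (by simp [← hw])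
  have h := congrArg (fun p => (p.coeff 1).coeff 0) hf
  simp at h

theorem exists_fiber_hom {c : k} (hc : c ≠ 0) : ∃ θ : S.B →ₐ[k] k[X], θ S.x = C c ∧ θ S.z = X ∧
    ∀ b, θ b = 0 → S.x - algebraMap k S.B c ∣ b := by
  have hunit : IsUnit (C c) := hc.isUnit.map C
  obtain ⟨Y, hY⟩ := (hunit.pow S.d).dvd (a := evalXZ (C c) X S.P)
  obtain ⟨T, hT⟩ := (hunit.pow S.e).dvd (a := evalXYZ (C c) Y X S.Q)
  have hpt : S.IsPoint (C c) Y X T := ⟨hY.symm, hT.symm⟩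
  refine ⟨hpt.lift, hpt.lift_x, hpt.lift_z, fun b hb => ?_⟩
  obtain ⟨n, p, hp⟩ := S.exists_pow_mul_eq_evalXZ b
  have hpc : p.map (aeval c).toRingHom = 0 := by
    have h := congrArg hpt.lift hp
    rwa [map_mul, hb, mul_zero, algHom_evalXZ, hpt.lift_x, hpt.lift_z, evalXZ_C_left, comp_X,
      eq_comm] at h
  obtain ⟨q, rfl⟩ : C (X - C c) ∣ p := (C_dvd_iff_dvd_coeff _ _).2 fun i => by
    rw [dvd_iff_isRoot, IsRoot.def, ← coe_aeval_eq_eval]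
    simpa using congrArg (fun q => q.coeff i) hpc
  have hdvd : S.x - algebraMap k S.B c ∣ algebraMap k S.B c ^ n * b := by
    rw [← sub_sub_cancel (S.x ^ n * b) (algebraMap k S.B c ^ n * b), ← sub_mul]
    refine dvd_sub ?_ ((sub_dvd_pow_sub_pow _ _ n).mul_right b)
    simp [hp]
  exact ((hc.isUnit.map (algebraMap k S.B)).pow n).dvd_mul_left.1 hdvd

end Localization

end DoubleDanielewski

/-! ### The images of `x` and `z` -/

namespace DoubleDanielewski

variable {k : Type*} [Field k] {S₁ S₂ : DoubleDanielewski k}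

section ImageOfX

theorem algebraMap_mul_eq_smul (S : DoubleDanielewski k) (a : k) (b : S.B) :
    algebraMap k S.B a * b = a • b := (Algebra.smul_def a b).symm

theorem exists_map_x_eq_aeval (hr₁ : 2 ≤ S₁.r) (hs₁ : 0 < S₁.s) (hr₂ : 0 < S₂.r) (hs₂ : 0 < S₂.s)
    (ψ : S₂.B ≃ₐ[k] S₁.B) : ∃ p : k[X], ψ S₂.x = aeval S₁.x p := by
  obtain ⟨M⟩ := S₁.nonempty_lexModel (by omega) hs₁
  obtain ⟨φ, hφ, φx, φz⟩ := S₂.exists_isExponential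
  have := isDomain_B hr₂ hs₂
  refine M.exists_eq_aeval_of_invariant hr₁ (hφ.conj ψ) ⟨ψ S₂.z, fun h => ?_⟩ (by simp [φx])
  have h1 : ψ (S₂.x ^ (S₂.d + S₂.e)) = 0 := by
    simpa [φz, coeff_zero_eq_eval_zero] using congrArg (fun q => q.coeff 1) h
  exact pow_ne_zero _ (x_ne_zero hr₂ hs₂) ((map_eq_zero_iff ψ ψ.injective).1 h1)

theorem exists_map_x_eq_linear (hr₁ : 2 ≤ S₁.r) (hs₁ : 0 < S₁.s) (hr₂ : 2 ≤ S₂.r)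
    (hs₂ : 0 < S₂.s) (ψ : S₂.B ≃ₐ[k] S₁.B) :
    ∃ a b : k, a ≠ 0 ∧ ψ S₂.x = a • S₁.x + algebraMap k S₁.B b := by
  obtain ⟨p, hp⟩ := exists_map_x_eq_aeval hr₁ hs₁ (by omega) hs₂ ψ
  obtain ⟨q, hq⟩ := exists_map_x_eq_aeval hr₂ hs₂ (by omega) hs₁ ψ.symm
  have hqp : q.comp p = X := aeval_x_injective (by omega) hs₁ <| by
    rw [aeval_comp, ← hp, aeval_X, aeval_algHom_apply, ← hq, ψ.apply_symm_apply]
  have hdeg : p.natDegree = 1 :=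
    Nat.eq_one_of_mul_eq_one_left ((natDegree_comp.symm.trans (congrArg _ hqp)).trans natDegree_X)
  obtain ⟨a, ha, b, rfl⟩ := natDegree_eq_one.1 hdeg
  exact ⟨a, b, ha, by simp [hp, ← algebraMap_mul_eq_smul]⟩

theorem exists_x_dvd_z_sub (hr : 0 < S₂.r) (ψ : S₂.B ≃ₐ[k] S₁.B) {a c : k} (ha : a ≠ 0)
    (hc : c ≠ 0) (hx : ψ S₂.x = a • (S₁.x - algebraMap k S₁.B c)) :
    ∃ v : k, S₂.x ∣ S₂.z - algebraMap k S₂.B v := by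
  obtain ⟨θ, θx, -, hker⟩ := S₁.exists_fiber_hom hc
  have hθx : θ (ψ S₂.x) = 0 := by
    rw [hx, map_smul, map_sub, θx, AlgHom.commutes]
    simp
  have hroot := (S₂.isPoint.map (θ.comp ψ.toAlgHom)).pow_d_mul
  simp only [AlgHom.comp_apply, AlgEquiv.toAlgHom_apply, hθx, zero_pow S₂.d_pos.ne',
    zero_mul] at hroot
  obtain ⟨v, hv⟩ := exists_eq_C_of_evalXZ_C_eq_zero (u := (0 : k)) (w := θ (ψ S₂.z)) S₂.P_monic
    hr.ne' (by rw [C_0, ← hroot])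
  refine ⟨v, (map_dvd_iff ψ).1 ?_⟩
  rw [hx, ← algebraMap_mul_eq_smul, (ha.isUnit.map (algebraMap k S₁.B)).mul_left_dvd]
  exact hker _ (by simp [hv])

theorem exists_map_x_eq_smul (hr₁ : 2 ≤ S₁.r) (hs₁ : 0 < S₁.s) (hr₂ : 2 ≤ S₂.r)
    (hs₂ : 0 < S₂.s) (ψ : S₂.B ≃ₐ[k] S₁.B) : ∃ a : k, a ≠ 0 ∧ ψ S₂.x = a • S₁.x := by
  obtain ⟨a, b, ha, h⟩ := exists_map_x_eq_linear hr₁ hs₁ hr₂ hs₂ ψ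
  refine ⟨a, ha, ?_⟩
  suffices hb : b = 0 by rw [h, hb, map_zero, add_zero]
  by_contra hb
  obtain ⟨v, hv⟩ := exists_x_dvd_z_sub (S₁ := S₁) (by omega) ψ ha
    (neg_ne_zero.2 (div_ne_zero hb ha)) <| by
      rw [h, map_neg, sub_neg_eq_add, smul_add, ← algebraMap_mul_eq_smul S₁ a (algebraMap k _ _),
        ← map_mul, mul_div_cancel₀ b ha]
  exact not_x_dvd_z_sub hr₂ hs₂ v hv

theorem symm_map_x {a : k} (ha : a ≠ 0) (ψ : S₂.B ≃ₐ[k] S₁.B) (hx : ψ S₂.x = a • S₁.x) :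
    ψ.symm S₁.x = a⁻¹ • S₂.x := by
  rw [ψ.symm_apply_eq, map_smul, hx, inv_smul_smul₀ ha]

end ImageOfX

section Orders

variable (S : DoubleDanielewski k)

/-- The greatest order of a pole along `x = 0` of an element of degree `N` in `z`, where `y` and the
leading part of `t` count as having degrees `r` and `r s` and poles of orders `d` and `d s + e`. -/
noncomputable def poleOrder (N : ℕ) : ℕ :=
  S.d * (N / S.r) + S.e * (N / (S.r * S.s))

variable {S}

namespace LexModel

theorem exists_orderTop_eq (M : S.LexModel) {b : S.B} (hb : b ≠ 0) :
    ∃ N l : ℕ, (M.toHahn b).orderTop = lexPair (-N) (l - S.poleOrder N) := by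
  obtain ⟨⟨l, i, j, m⟩, ⟨hi, hj⟩, ho, -⟩ := M.exists_orderTop_eq_and_mem_span hb
  dsimp only at hi hj
  have hr : 0 < S.r := Nat.zero_lt_of_lt hi
  have hs : 0 < S.s := Nat.zero_lt_of_lt hj
  have h₁ : (i + S.r * (j + S.s * m)) / S.r = j + S.s * m := by
    rw [Nat.add_mul_div_left _ _ hr, Nat.div_eq_of_lt hi, zero_add]
  have h₂ : (j + S.s * m) / S.s = m := by
    rw [Nat.add_mul_div_left _ _ hs, Nat.div_eq_of_lt hj, zero_add]
  refine ⟨i + S.r * (j + S.s * m), l, ho.trans ?_⟩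
  rw [poleOrder, ← Nat.div_div_eq_div_mul, h₁, h₂, lexWeight]
  push_cast
  congr 2 <;> ring

theorem exists_orderTop_eq_neg_poleOrder (M : S.LexModel) (N : ℕ) :
    ∃ b : S.B, (M.toHahn b).orderTop = lexPair (-N) (-S.poleOrder N) := by
  refine ⟨stripMonomial S.x S.y S.z M.t (0, N % S.r, N / S.r % S.s, N / (S.r * S.s)),
    (M.orderTop_stripMonomial _).trans ?_⟩
  have h₁ : (N : ℚ) = (N % S.r : ℕ) + S.r * (N / S.r : ℕ) := by
    exact_mod_cast (Nat.mod_add_div N S.r).symm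
  have h₂ : ((N / S.r : ℕ) : ℚ) = (N / S.r % S.s : ℕ) + S.s * (N / (S.r * S.s) : ℕ) := by
    rw [← Nat.div_div_eq_div_mul]
    exact_mod_cast (Nat.mod_add_div _ S.s).symm
  rw [lexWeight, poleOrder, WithTop.coe_inj, lexPair_inj]
  push_cast
  constructor
  · linear_combination h₁ + S.r * h₂
  · linear_combination S.d * h₂

theorem orderTop_eq_of_orderTop_x_of_orderTop_z (M : S.LexModel)
    {φ : S.B →ₐ[k] HahnSeries (ℚ ×ₗ ℚ) k}
    (hx : (φ S.x).orderTop = lexPair 0 1) (hz : (φ S.z).orderTop = lexPair (-1) 0) (b : S.B) :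
    (φ b).orderTop = (M.toHahn b).orderTop := by
  obtain ⟨n, p, hp⟩ := S.exists_pow_mul_eq_evalXZ b
  rcases eq_or_ne p 0 with rfl | hp0
  · have hb : b = 0 := S.isLeftRegular_x.pow n (by simpa [← evalXZHom_apply] using hp)
    simp [hb]
  have hφ := congrArg (fun a => (φ a).orderTop) hp
  have hM := congrArg (fun a => (M.toHahn a).orderTop) hp
  simp only [map_mul, map_pow, HahnSeries.orderTop_mul, orderTop_pow_of_eq hx,
    orderTop_pow_of_eq M.orderTop_x, M.orderTop_evalXZ hp0, algHom_evalXZ φ,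
    _root_.orderTop_evalXZ hx hz hp0] at hφ hM
  exact WithTop.add_left_cancel WithTop.coe_ne_top (hφ.trans hM.symm)

end LexModel

end Orders

section ImageOfZ

open LexModel

theorem exists_map_z_eq_linear (hr₁ : 2 ≤ S₁.r) (hs₁ : 0 < S₁.s) {a : k} (ha : a ≠ 0)
    (ψ : S₂.B ≃ₐ[k] S₁.B) (hx : ψ S₂.x = a • S₁.x) :
    ∃ p q : k[X], ψ S₂.z = aeval S₁.x p * S₁.z + aeval S₁.x q := by
  obtain ⟨M⟩ := S₁.nonempty_lexModel (by omega) hs₁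
  suffices h : ∀ v : ℚ, (lexPair (-(2 : ℕ)) v : WithTop (ℚ ×ₗ ℚ)) < (M.toHahn (ψ S₂.z)).orderTop by
    obtain ⟨f, hf, hfz⟩ := M.exists_eq_evalXZ hr₁ h
    obtain ⟨p, q, rfl⟩ := exists_eq_X_add_C_of_natDegree_le_one
      (natDegree_le_of_degree_le (Order.le_of_lt_succ hf))
    exact ⟨p, q, by simp [hfz]⟩
  intro v
  rcases eq_or_ne (ψ S₂.z) 0 with h0 | h0
  · simp [h0]
  obtain ⟨N, l, ho⟩ := M.exists_orderTop_eq h0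
  suffices hN : N ≤ 1 by
    rw [ho, WithTop.coe_lt_coe, lexPair_lt_lexPair]
    left
    have : (N : ℚ) ≤ 1 := by exact_mod_cast hN
    push_cast
    linarith
  by_contra! hN
  obtain ⟨n, p, hp⟩ := S₂.exists_pow_mul_eq_evalXZ (ψ.symm S₁.z)
  have hx' : (M.toHahn (ψ S₂.x)).orderTop = lexPair 0 1 := by
    rw [hx, map_smul, orderTop_smul_of_ne_zero ha, M.orderTop_x]
  have hp0 : p ≠ 0 := by
    rintro rfl
    have hz : ψ.symm S₁.z = 0 := S₂.isLeftRegular_x.pow n (by simpa [← evalXZHom_apply] using hp)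
    simpa [(map_eq_zero_iff ψ.symm ψ.symm.injective).1 hz] using M.orderTop_z
  have hdeg := congrArg (fun b => ((M.toHahn.comp ψ.toAlgHom) b).orderTop) hp
  simp only [algHom_evalXZ] at hdeg
  simp only [AlgHom.comp_apply, AlgEquiv.toAlgHom_apply, map_mul, map_pow, ψ.apply_symm_apply,
    HahnSeries.orderTop_mul, M.orderTop_z] at hdeg
  rw [orderTop_evalXZ_of_eq hx' (by positivity) ho hp0, orderTop_pow_of_eq hx', ← WithTop.coe_add,
    nsmul_lexPair, lexPair_add, WithTop.coe_inj, lexPair_inj] at hdeg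
  have h1 : p.natDegree * N = 1 := by
    have : (p.natDegree * N : ℚ) = 1 := by linarith [hdeg.1]
    exact_mod_cast this
  exact hN.ne' (Nat.eq_one_of_mul_eq_one_left h1)

theorem aeval_smul_eq_aeval_comp (S : DoubleDanielewski k) (a : k) (p : k[X]) :
    aeval (a • S.x) p = aeval S.x (p.comp (C a * X)) := by
  simp [aeval_comp, algebraMap_mul_eq_smul]

theorem exists_map_z_eq (hr₁ : 2 ≤ S₁.r) (hs₁ : 0 < S₁.s) (hr₂ : 2 ≤ S₂.r) (hs₂ : 0 < S₂.s)
    {a : k} (ha : a ≠ 0) (ψ : S₂.B ≃ₐ[k] S₁.B) (hx : ψ S₂.x = a • S₁.x) :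
    ∃ (c : k) (δ : k[X]), c ≠ 0 ∧ ψ S₂.z = c • S₁.z + aeval S₁.x δ := by
  obtain ⟨p, q, hpq⟩ := exists_map_z_eq_linear hr₁ hs₁ ha ψ hx
  obtain ⟨p', q', hpq'⟩ := exists_map_z_eq_linear hr₂ hs₂ (inv_ne_zero ha) ψ.symm
    (symm_map_x ha ψ hx)
  have hψ : ∀ f : k[X], ψ (aeval S₂.x f) = aeval S₁.x (f.comp (C a * X)) := fun f => by
    rw [← aeval_algHom_apply, hx, aeval_smul_eq_aeval_comp]
  have hz : S₁.z = ψ (aeval S₂.x p' * S₂.z + aeval S₂.x q') := by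
    rw [← hpq', ψ.apply_symm_apply]
  have hX : (X : k[X][X]) = C (p'.comp (C a * X)) * (C p * X + C q) + C (q'.comp (C a * X)) := by
    refine evalXZ_injective (by omega) hs₁ ?_
    rw [map_add, map_mul, hψ, hψ, hpq] at hz
    simpa only [evalXZ_X, evalXZ_add, evalXZ_mul, evalXZ_C] using hz
  have hp : p'.comp (C a * X) * p = 1 := by
    simpa using (congrArg (fun f => f.coeff 1) hX).symm
  obtain ⟨c, hc, rfl⟩ := Polynomial.isUnit_iff.1 (IsUnit.of_mul_eq_one_right _ hp)
  exact ⟨c, q, hc.ne_zero, by rw [hpq, aeval_C, algebraMap_mul_eq_smul]⟩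

end ImageOfZ

end DoubleDanielewski

/-! ### Pole orders and the image of `y` -/

section Substitution

variable {R : Type*} [CommRing R]

theorem degree_comp_linear_sub_lt [IsDomain R] {k : Type*} [Field k] [Algebra k R] {p q : R[X]}
    (hp : p.Monic) (hq : q.Monic) (hpq : p.natDegree = q.natDegree) {c : k} (hc : c ≠ 0) (b : R) :
    (p.comp (c • X + C b) - c ^ q.natDegree • q).degree < q.natDegree := by
  have hcR : algebraMap k R c ≠ 0 := (map_ne_zero_iff _ (algebraMap k R).injective).2 hc
  have hlin : (c • X + C b : R[X]) = C (algebraMap k R c) * X + C b := by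
    rw [← algebraMap_smul R c (X : R[X]), smul_eq_C_mul]
  have hsmul : c ^ q.natDegree • q = C (algebraMap k R c ^ q.natDegree) * q := by
    rw [← map_pow, ← algebraMap_smul R (c ^ q.natDegree) q, smul_eq_C_mul]
  have hpow : algebraMap k R c ^ q.natDegree ≠ 0 := pow_ne_zero _ hcR
  have hlead : (p.comp (c • X + C b)).leadingCoeff = algebraMap k R c ^ q.natDegree := by
    rw [hlin, leadingCoeff_comp (by rw [natDegree_linear hcR]; exact one_ne_zero),
      hp.leadingCoeff, leadingCoeff_linear hcR, one_mul, hpq]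
  have h0 : p.comp (c • X + C b) ≠ 0 := leadingCoeff_ne_zero.1 (hlead ▸ hpow)
  have hdeg : (p.comp (c • X + C b)).degree = q.natDegree := by
    rw [degree_eq_natDegree h0, natDegree_comp, hlin, natDegree_linear hcR, mul_one, hpq]
  rw [← hdeg]
  refine degree_sub_lt_left ?_ h0 ?_
  · rw [hdeg, hsmul, degree_C_mul hpow, degree_eq_natDegree hq.ne_zero]
  · rw [hlead, hsmul, leadingCoeff_mul, leadingCoeff_C, hq.leadingCoeff, mul_one]

theorem exists_eq_mul_C_of_eq_add [Nontrivial R] {q D α β : R[X]} {c : R} (hq : q.Monic)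
    (hD : D.degree < q.degree) (h : D = α * q + β * C c) :
    ∃ f : R[X], f.degree < q.degree ∧ D = f * C c := by
  have hlt : (β %ₘ q).degree < q.degree := degree_modByMonic_lt _ hq
  refine ⟨β %ₘ q, hlt, ?_⟩
  have hdvd : D - β %ₘ q * C c = q * (α + β /ₘ q * C c) := by
    rw [h]
    nth_rw 1 [← modByMonic_add_div β q]
    ring
  have hdeg : (D - β %ₘ q * C c).degree < q.degree := by
    refine (degree_sub_le _ _).trans_lt (max_lt hD (lt_of_le_of_lt ?_ hlt))
    rw [mul_comm, ← smul_eq_C_mul]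
    exact degree_smul_le _ _
  exact sub_eq_zero.1 ((modByMonic_eq_zero_iff_dvd hq).2 ⟨_, hdvd⟩ ▸
    ((modByMonic_eq_self_iff hq).2 hdeg).symm)

end Substitution

namespace DoubleDanielewski

variable {k : Type*} [Field k] {S₁ S₂ : DoubleDanielewski k}

section Invariants

open LexModel

theorem poleOrder_le (hr₁ : 2 ≤ S₁.r) (hs₁ : 0 < S₁.s) (hr₂ : 2 ≤ S₂.r) (hs₂ : 0 < S₂.s)
    (ψ : S₂.B ≃ₐ[k] S₁.B) (N : ℕ) : S₂.poleOrder N ≤ S₁.poleOrder N := by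
  obtain ⟨M₁⟩ := S₁.nonempty_lexModel (by omega) hs₁
  obtain ⟨M₂⟩ := S₂.nonempty_lexModel (by omega) hs₂
  obtain ⟨a, ha, hx⟩ := exists_map_x_eq_smul hr₁ hs₁ hr₂ hs₂ ψ
  obtain ⟨c, δ, hc, hz⟩ := exists_map_z_eq hr₁ hs₁ hr₂ hs₂ ha ψ hx
  have hx' : (M₁.toHahn (ψ S₂.x)).orderTop = lexPair 0 1 := by
    rw [hx, map_smul, orderTop_smul_of_ne_zero ha, M₁.orderTop_x]
  have hz' : (M₁.toHahn (ψ S₂.z)).orderTop = lexPair (-1) 0 := by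
    have hlin : ψ S₂.z = evalXZ S₁.x S₁.z (C (C c) * X + C δ) := by
      simp [hz, algebraMap_mul_eq_smul]
    rw [hlin, M₁.orderTop_evalXZ (by simp [← leadingCoeff_ne_zero, leadingCoeff_linear, hc])]
    simp [leadingCoeff_linear, hc]
  obtain ⟨b, hb⟩ := M₂.exists_orderTop_eq_neg_poleOrder N
  have hψb : (M₁.toHahn (ψ b)).orderTop = lexPair (-N) (-S₂.poleOrder N) :=
    (M₂.orderTop_eq_of_orderTop_x_of_orderTop_z (φ := M₁.toHahn.comp ψ.toAlgHom) hx' hz' b).trans hb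
  have hb0 : ψ b ≠ 0 := fun h => by simp [h] at hψb
  obtain ⟨N', l, ho⟩ := M₁.exists_orderTop_eq hb0
  obtain ⟨hN, hl⟩ := lexPair_inj.1 (WithTop.coe_inj.1 (hψb.symm.trans ho))
  obtain rfl : N = N' := by exact_mod_cast neg_inj.1 hN
  have : (S₂.poleOrder N : ℚ) ≤ S₁.poleOrder N := by linarith [Nat.cast_nonneg (α := ℚ) l]
  exact_mod_cast this

theorem poleOrder_eq (hr₁ : 2 ≤ S₁.r) (hs₁ : 0 < S₁.s) (hr₂ : 2 ≤ S₂.r) (hs₂ : 0 < S₂.s)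
    (ψ : S₂.B ≃ₐ[k] S₁.B) : S₁.poleOrder = S₂.poleOrder :=
  funext fun N => (poleOrder_le hr₂ hs₂ hr₁ hs₁ ψ.symm N).antisymm
    (poleOrder_le hr₁ hs₁ hr₂ hs₂ ψ N)

variable (S : DoubleDanielewski k)

theorem poleOrder_eq_zero_iff (hr : 0 < S.r) (hs : 0 < S.s) {N : ℕ} :
    S.poleOrder N = 0 ↔ N < S.r := by
  have hd := S.d_pos
  have he := S.e_pos
  have hrs : S.r ≤ S.r * S.s := Nat.le_mul_of_pos_right _ hs
  simp only [poleOrder, Nat.add_eq_zero_iff, Nat.mul_eq_zero, hd.ne', he.ne', false_or,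
    Nat.div_eq_zero_iff, hr.ne', (Nat.mul_pos hr hs).ne']
  omega

theorem poleOrder_r_mul (hr : 0 < S.r) (N : ℕ) :
    S.poleOrder (S.r * N) = S.d * N + S.e * (N / S.s) := by
  rw [poleOrder, Nat.mul_div_cancel_left _ hr, Nat.mul_div_mul_left _ _ hr]

variable {S}

theorem r_eq_of_poleOrder_eq (hr₁ : 0 < S₁.r) (hs₁ : 0 < S₁.s) (hr₂ : 0 < S₂.r) (hs₂ : 0 < S₂.s)
    (h : S₁.poleOrder = S₂.poleOrder) : S₁.r = S₂.r := by
  have hiff (N : ℕ) : N < S₁.r ↔ N < S₂.r := by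
    rw [← poleOrder_eq_zero_iff _ hr₁ hs₁, ← poleOrder_eq_zero_iff _ hr₂ hs₂, h]
  exact le_antisymm (not_lt.1 fun hlt => lt_irrefl _ ((hiff _).1 hlt))
    (not_lt.1 fun hlt => lt_irrefl _ ((hiff _).2 hlt))

theorem d_e_s_eq_of_poleOrder_eq (hr : 0 < S₁.r) (hs₁ : 1 < S₁.s) (hs₂ : 0 < S₂.s)
    (hrr : S₁.r = S₂.r) (h : S₁.poleOrder = S₂.poleOrder) :
    S₁.d = S₂.d ∧ S₁.e = S₂.e ∧ S₁.s = S₂.s := by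
  have hmul (N : ℕ) : S₁.d * N + S₁.e * (N / S₁.s) = S₂.d * N + S₂.e * (N / S₂.s) := by
    rw [← poleOrder_r_mul _ hr, ← poleOrder_r_mul _ (hrr ▸ hr), hrr, h]
  have he₁ := S₁.e_pos
  have he₂ := S₂.e_pos
  have hone := hmul 1
  have hs₁' := hmul S₁.s
  have hs₂' := hmul S₂.s
  rw [Nat.div_eq_of_lt hs₁] at hone
  rw [Nat.div_self (by omega)] at hs₁' hs₂'
  obtain hs₂ | hs₂ : S₂.s = 1 ∨ 1 < S₂.s := by omega
  · simp only [hs₂, Nat.div_one] at hone hs₁'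
    nlinarith
  rw [Nat.div_eq_of_lt hs₂] at hone
  obtain hd : S₁.d = S₂.d := by omega
  rw [hd, Nat.add_left_cancel_iff] at hs₁' hs₂'
  rcases lt_trichotomy S₁.s S₂.s with hlt | heq | hgt
  · rw [Nat.div_eq_of_lt hlt] at hs₁'
    omega
  · rw [heq, Nat.div_self (by omega)] at hs₁'
    exact ⟨hd, by omega, heq⟩
  · rw [Nat.div_eq_of_lt hgt] at hs₂'
    omega

theorem s_eq_of_poleOrder_eq (hr : 0 < S₁.r) (hs₁ : 0 < S₁.s) (hs₂ : 0 < S₂.s)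
    (hrr : S₁.r = S₂.r) (h : S₁.poleOrder = S₂.poleOrder) : S₁.s = S₂.s := by
  rcases (Nat.succ_le_iff.2 hs₁).eq_or_lt with h₁ | h₁
  · rcases (Nat.succ_le_iff.2 hs₂).eq_or_lt with h₂ | h₂
    · exact h₁.symm.trans h₂
    · exact (d_e_s_eq_of_poleOrder_eq (hrr ▸ hr) h₂ hs₁ hrr.symm h.symm).2.2.symm
  · exact (d_e_s_eq_of_poleOrder_eq hr h₁ hs₂ hrr h).2.2

end Invariants

section ImageOfY

variable {a c : k} {δ : k[X]}

theorem evalXZ_smul_X_linear {A : Type*} [CommRing A] [Algebra k A] (x z : A) (p : k[X][X]) :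
    evalXZ x z (evalXZ (a • C X : k[X][X]) (c • X + C δ) p) =
      evalXZ (a • x) (c • z + aeval x δ) p := by
  rw [← evalXZHom_apply, algHom_evalXZ]
  simp [evalXZHom_apply]

theorem degree_evalXZ_P_sub_lt (hr : S₁.r = S₂.r) (hc : c ≠ 0) (u : k[X]) (δ : k[X]) :
    (evalXZ (C u) (c • X + C δ) S₂.P - c ^ S₁.r • S₁.P).degree < S₁.r := by
  rw [evalXZ_C_left]
  exact degree_comp_linear_sub_lt (S₂.P_monic.map _) S₁.P_monic
    ((S₂.P_monic.natDegree_map _).trans hr.symm) hc δ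

theorem exists_map_y_eq (hr₁ : 0 < S₁.r) (hs₁ : 0 < S₁.s) (hr : S₁.r = S₂.r) (hd : S₁.d = S₂.d)
    (ha : a ≠ 0) (hc : c ≠ 0) (ψ : S₂.B →ₐ[k] S₁.B) (hx : ψ S₂.x = a • S₁.x)
    (hz : ψ S₂.z = c • S₁.z + aeval S₁.x δ) :
    ∃ f : k[X][X], f.degree < S₁.r ∧
      ψ S₂.y = ((a ^ S₁.d)⁻¹ * c ^ S₁.r) • S₁.y + evalXZ S₁.x S₁.z ((a ^ S₁.d)⁻¹ • f) ∧
      evalXZ (a • C X : k[X][X]) (c • X + C δ) S₂.P = c ^ S₁.r • S₁.P + C X ^ S₁.d * f := by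
  set p := evalXZ (a • C X : k[X][X]) (c • X + C δ) S₂.P - c ^ S₁.r • S₁.P with hp
  have hdeg : p.degree < S₁.r := by
    rw [hp, smul_C]
    exact degree_evalXZ_P_sub_lt hr hc _ δ
  have hψ : S₁.x ^ S₁.d * (a ^ S₁.d • ψ S₂.y - c ^ S₁.r • S₁.y) = evalXZ S₁.x S₁.z p := by
    have hrel := (S₂.isPoint.map ψ).pow_d_mul
    rw [hx, hz, ← hd, ← evalXZ_smul_X_linear] at hrel
    rw [hp, evalXZ_sub, evalXZ_smul, ← hrel, ← S₁.isPoint.pow_d_mul]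
    simp only [← algebraMap_mul_eq_smul, map_pow]
    ring
  obtain ⟨f, hf, hy, hpf⟩ := exists_eq_evalXZ_of_pow_mul hs₁ le_rfl hr₁ hdeg hψ
  refine ⟨f, hf, ?_, ?_⟩
  · rw [evalXZ_smul, ← hy, mul_smul, ← smul_add, add_sub_cancel,
      inv_smul_smul₀ (pow_ne_zero _ ha)]
  · rw [← hpf, hp, add_sub_cancel]

theorem evalXZ_zero_eq {f : k[X][X]}
    (h : evalXZ (a • C X : k[X][X]) (c • X + C δ) S₂.P = c ^ S₁.r • S₁.P + C X ^ S₁.d * f) :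
    evalXZ (0 : k[X]) (c • X + C (δ.eval 0)) S₂.P = c ^ S₁.r • evalXZ (0 : k[X]) X S₁.P := by
  have h0 := congrArg (evalXZHom (0 : k[X]) X) h
  rw [algHom_evalXZ] at h0
  simpa [evalXZHom_apply, zero_pow S₁.d_pos.ne', ← coeff_zero_eq_aeval_zero',
    coeff_zero_eq_eval_zero] using h0

end ImageOfY

end DoubleDanielewski

end

/-! ### The ideal `(Q, G, X ^ e)` -/

section

open scoped Polynomial
open MvPolynomial (X)

namespace NewCoord

variable {k : Type*} [Field k] {a c u : k} (δ : k[X]) (g : k[X][X])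

/-- The automorphism of `k[X, Y, Z]` with `(X, Y, Z) ↦ (X₂, Y₂, Z₂)`. -/
noncomputable def substEquiv (ha : a ≠ 0) (hc : c ≠ 0) (hu : u ≠ 0) :
    MvPolynomial (Fin 3) k ≃ₐ[k] MvPolynomial (Fin 3) k :=
  AlgEquiv.ofAlgHom (MvPolynomial.aeval ![X₂ a, Y₂ u g, Z₂ c δ])
    (MvPolynomial.aeval ![a⁻¹ • X 0,
      u⁻¹ • (X 1 - evalXZ (a⁻¹ • X 0)
        (c⁻¹ • (X 2 - Polynomial.aeval (a⁻¹ • X 0) δ)) g),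
      c⁻¹ • (X 2 - Polynomial.aeval (a⁻¹ • X 0) δ)])
    (by
      refine MvPolynomial.algHom_ext fun i => ?_
      fin_cases i <;>
        simp [X₂, Y₂, Z₂, algHom_evalXZ, ← Polynomial.aeval_algHom_apply, ha, hc, hu])
    (by
      refine MvPolynomial.algHom_ext fun i => ?_
      fin_cases i <;>
        simp [X₂, Y₂, Z₂, algHom_evalXZ, ← Polynomial.aeval_algHom_apply, ha, hc, hu])

@[simp] theorem substEquiv_X_zero (ha : a ≠ 0) (hc : c ≠ 0) (hu : u ≠ 0) :
    substEquiv δ g ha hc hu (X 0) = X₂ a :=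
  MvPolynomial.aeval_X _ _

@[simp] theorem substEquiv_X_one (ha : a ≠ 0) (hc : c ≠ 0) (hu : u ≠ 0) :
    substEquiv δ g ha hc hu (X 1) = Y₂ u g :=
  MvPolynomial.aeval_X _ _

@[simp] theorem substEquiv_X_two (ha : a ≠ 0) (hc : c ≠ 0) (hu : u ≠ 0) :
    substEquiv δ g ha hc hu (X 2) = Z₂ c δ :=
  MvPolynomial.aeval_X _ _

theorem adjoin_eq_top (ha : a ≠ 0) (hc : c ≠ 0) (hu : u ≠ 0) :
    Algebra.adjoin k {X₂ a, Y₂ u g, Z₂ c δ} = ⊤ := by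
  have h : ({X₂ a, Y₂ u g, Z₂ c δ} : Set (MvPolynomial (Fin 3) k)) =
      (substEquiv δ g ha hc hu).toAlgHom '' Set.range X := by
    ext p
    simp [Fin.exists_fin_succ, eq_comm]
  rw [h, ← AlgHom.map_adjoin, MvPolynomial.adjoin_range_X, Algebra.map_top, AlgHom.range_eq_top]
  exact (substEquiv δ g ha hc hu).surjective

end NewCoord

namespace DoubleDanielewski

open NewCoord

variable {k : Type*} [Field k]

section CoordinateMap

variable (S : DoubleDanielewski k) {A A' : Type*} [CommRing A] [Algebra k A] [CommRing A']
  [Algebra k A']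

theorem algHom_polyG (f : A →ₐ[k] A') (a b c : A) :
    f (S.polyG a b c) = S.polyG (f a) (f b) (f c) := by
  simp [polyG, algHom_evalXZ]

theorem map_tripleIdeal (f : A →ₐ[k] A') (a b c : A) :
    (S.tripleIdeal a b c).map f = S.tripleIdeal (f a) (f b) (f c) := by
  rw [tripleIdeal, tripleIdeal, Ideal.map_span]
  simp [Set.image_insert_eq, algHom_evalXYZ, algHom_polyG]

theorem evalXYZ_Q_mem_tripleIdeal (a b c : A) : evalXYZ a b c S.Q ∈ S.tripleIdeal a b c :=
  Ideal.subset_span (by simp)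

theorem polyG_mem_tripleIdeal (a b c : A) : S.polyG a b c ∈ S.tripleIdeal a b c :=
  Ideal.subset_span (by simp)

theorem pow_e_mem_tripleIdeal (a b c : A) : a ^ S.e ∈ S.tripleIdeal a b c :=
  Ideal.subset_span (by simp)

/-- The homomorphism `k[X, Y, Z] → B` with image `k[x, y, z]`. -/
noncomputable def coordHom : MvPolynomial (Fin 3) k →ₐ[k] S.B :=
  MvPolynomial.aeval ![S.x, S.y, S.z]

@[simp] theorem coordHom_X_zero : S.coordHom (X 0) = S.x := MvPolynomial.aeval_X _ _

@[simp] theorem coordHom_X_one : S.coordHom (X 1) = S.y := MvPolynomial.aeval_X _ _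

@[simp] theorem coordHom_X_two : S.coordHom (X 2) = S.z := MvPolynomial.aeval_X _ _

theorem polyG_eq_zero : S.polyG S.x S.y S.z = 0 := by
  rw [polyG, ← S.isPoint.pow_d_mul, sub_self]

theorem tripleIdeal_x_y_z : S.tripleIdeal S.x S.y S.z = Ideal.span {S.x ^ S.e} := by
  refine le_antisymm (Ideal.span_le.2 ?_)
    ((Ideal.span_singleton_le_iff_mem _).2 (S.pow_e_mem_tripleIdeal _ _ _))
  rintro _ (rfl | rfl | rfl)
  · exact Ideal.mem_span_singleton.2 ⟨S.t, S.isPoint.pow_e_mul.symm⟩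
  · simp [polyG_eq_zero]
  · exact Ideal.mem_span_singleton_self _

theorem exists_comp_coordHom_eq (η : MvPolynomial (Fin 3) k →ₐ[k] A)
    (hG : S.polyG (η (X 0)) (η (X 1)) (η (X 2)) = 0)
    (hQ : η (X 0) ^ S.e ∣
      evalXYZ (η (X 0)) (η (X 1)) (η (X 2)) S.Q) :
    ∃ f : S.B →ₐ[k] A, f.comp S.coordHom = η := by
  obtain ⟨w, hw⟩ := hQ
  have hpt : S.IsPoint _ _ _ w := ⟨(sub_eq_zero.1 hG).symm, hw.symm⟩
  refine ⟨hpt.lift, MvPolynomial.algHom_ext fun i => ?_⟩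
  fin_cases i <;> simp

theorem x_pow_e_dvd_coordHom_iff {p : MvPolynomial (Fin 3) k} :
    S.x ^ S.e ∣ S.coordHom p ↔ p ∈ S.tripleIdeal (X 0) (X 1) (X 2) := by
  constructor
  · rintro ⟨b, hb⟩
    let π := Ideal.Quotient.mkₐ k (S.tripleIdeal (A := MvPolynomial (Fin 3) k) (X 0) (X 1) (X 2))
    have hπ {q} (hq : q ∈ S.tripleIdeal (X 0) (X 1) (X 2)) : π q = 0 :=
      Ideal.Quotient.eq_zero_iff_mem.2 hq
    obtain ⟨θ, hθ⟩ := S.exists_comp_coordHom_eq π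
      (by rw [← algHom_polyG, hπ (S.polyG_mem_tripleIdeal _ _ _)])
      (by rw [← algHom_evalXYZ, hπ (S.evalXYZ_Q_mem_tripleIdeal _ _ _)]; exact dvd_zero _)
    have hx : θ S.x ^ S.e = 0 := by
      rw [← coordHom_X_zero, ← AlgHom.comp_apply, hθ, ← map_pow,
        hπ (S.pow_e_mem_tripleIdeal _ _ _)]
    refine Ideal.Quotient.eq_zero_iff_mem.1 ((DFunLike.congr_fun hθ p).symm.trans ?_)
    rw [AlgHom.comp_apply, hb, map_mul, map_pow, hx, zero_mul]
  · intro hp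
    have hmap := Ideal.mem_map_of_mem S.coordHom hp
    rw [map_tripleIdeal] at hmap
    simpa [tripleIdeal_x_y_z, Ideal.mem_span_singleton] using hmap

end CoordinateMap

variable {S₁ S₂ : DoubleDanielewski k}

section Lifting

theorem exists_comp_coordHom_eq_coordHom_comp
    (σ : MvPolynomial (Fin 3) k →ₐ[k] MvPolynomial (Fin 3) k) (he : S₂.e ≤ S₁.e)
    (hX : σ (X 0) ∣ X 0)
    (hG : S₁.polyG (X 0) (X 1) (X 2) ∣
      σ (S₂.polyG (X 0) (X 1) (X 2)))
    (hI : (S₂.tripleIdeal (X 0) (X 1) (X 2)).map σ ≤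
      S₁.tripleIdeal (X 0) (X 1) (X 2)) :
    ∃ f : S₂.B →ₐ[k] S₁.B, f.comp S₂.coordHom = S₁.coordHom.comp σ := by
  refine S₂.exists_comp_coordHom_eq _ ?_ ?_
  · have h := map_dvd S₁.coordHom hG
    rw [algHom_polyG, coordHom_X_zero, coordHom_X_one, coordHom_X_two, polyG_eq_zero,
      zero_dvd_iff] at h
    rw [← h, ← AlgHom.comp_apply, ← algHom_polyG]
  · rw [← algHom_evalXYZ]
    have hx : S₁.coordHom (σ (X 0)) ∣ S₁.x := by
      simpa using map_dvd S₁.coordHom hX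
    exact ((pow_dvd_pow_of_dvd hx _).trans (pow_dvd_pow _ he)).trans <|
      S₁.x_pow_e_dvd_coordHom_iff.2 <|
        hI (Ideal.mem_map_of_mem _ (S₂.evalXYZ_Q_mem_tripleIdeal _ _ _))

theorem comp_eq_id_of_comp_coordHom {S : DoubleDanielewski k} {f : S.B →ₐ[k] S.B}
    (h : f.comp S.coordHom = S.coordHom) : f = AlgHom.id k S.B := by
  have hx : f S.x = S.x := by simpa using DFunLike.congr_fun h (X 0)
  have hz : f S.z = S.z := by simpa using DFunLike.congr_fun h (X 2)
  exact hom_ext hx hz (by rw [hx]; exact S.isLeftRegular_x)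

theorem nonempty_algEquiv_of_coord
    (σ : MvPolynomial (Fin 3) k ≃ₐ[k] MvPolynomial (Fin 3) k) (he : S₁.e = S₂.e)
    (hX : Associated (σ (X 0)) (X 0))
    (hG : Associated (σ (S₂.polyG (X 0) (X 1) (X 2)))
      (S₁.polyG (X 0) (X 1) (X 2)))
    (hI : (S₂.tripleIdeal (X 0) (X 1) (X 2)).map
        σ.toAlgHom =
      S₁.tripleIdeal (X 0) (X 1) (X 2)) :
    Nonempty (S₁.B ≃ₐ[k] S₂.B) := by
  obtain ⟨f, hf⟩ := exists_comp_coordHom_eq_coordHom_comp σ.toAlgHom he.ge hX.dvd hG.dvd' hI.le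
  obtain ⟨f', hf'⟩ := exists_comp_coordHom_eq_coordHom_comp (S₁ := S₂) (S₂ := S₁)
    σ.symm.toAlgHom he.le ((map_dvd_iff σ).1 (by simpa using hX.dvd'))
    ((map_dvd_iff σ).1 (by simpa using hG.dvd))
    (by
      rw [← hI, Ideal.map_mapₐ]
      simp)
  refine ⟨AlgEquiv.ofAlgHom f' f (comp_eq_id_of_comp_coordHom ?_) (comp_eq_id_of_comp_coordHom ?_)⟩
  · rw [AlgHom.comp_assoc, hf, ← AlgHom.comp_assoc, hf', AlgHom.comp_assoc]
    simp
  · rw [AlgHom.comp_assoc, hf', ← AlgHom.comp_assoc, hf, AlgHom.comp_assoc]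
    simp

theorem map_tripleIdeal_eq_of_comp_coordHom
    {σ : MvPolynomial (Fin 3) k →ₐ[k] MvPolynomial (Fin 3) k}
    (hσ : Function.Surjective σ) (he : S₁.e = S₂.e) (ψ : S₂.B ≃ₐ[k] S₁.B)
    (hx : Associated (ψ S₂.x) S₁.x)
    (h : S₁.coordHom.comp σ = ψ.toAlgHom.comp S₂.coordHom) :
    (S₂.tripleIdeal (X 0) (X 1) (X 2)).map σ = S₁.tripleIdeal (X 0) (X 1) (X 2) := by
  have hcomap : S₂.tripleIdeal (X 0) (X 1) (X 2) =
      (S₁.tripleIdeal (X 0) (X 1) (X 2)).comap σ := by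
    ext p
    have hp : ψ (S₂.coordHom p) = S₁.coordHom (σ p) := (DFunLike.congr_fun h p).symm
    rw [Ideal.mem_comap, ← x_pow_e_dvd_coordHom_iff, ← x_pow_e_dvd_coordHom_iff, ← map_dvd_iff ψ,
      map_pow, hp, he, (hx.pow_pow (n := S₂.e)).dvd_iff_dvd_left]
  rw [hcomap, Ideal.map_comap_of_surjective _ hσ]

end Lifting

end DoubleDanielewski

end

/-! ### Consequences for the new coordinates -/

section

open Polynomial

section Evaluation

variable {k A : Type*} [CommRing k] [CommRing A] [Algebra k A]

theorem evalXZ_C_C (u w : A) (p : k[X][X]) : evalXZ (C u) (C w) p = C (evalXZ u w p) :=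
  (algHom_evalXZ ((CAlgHom (R := A) (A := A)).restrictScalars k) u w p).symm

theorem evalXYZ_C_left (u w : A) (v : A[X]) (q : k[X][X][X]) :
    evalXYZ (C u) v (C w) q = (q.map (evalXZHom u w).toRingHom).comp v := by
  rw [evalXYZ, comp, eval₂_map]
  exact congrArg (eval₂ · v q) (RingHom.ext (evalXZ_C_C u w))

theorem aeval_zero_eq_C (p : k[X]) : aeval (0 : k[X][X]) p = C (C (p.eval 0)) := by
  rw [← coeff_zero_eq_aeval_zero', coeff_zero_eq_eval_zero]
  rfl

theorem associated_smul {k A : Type*} [Field k] [CommRing A] [Algebra k A] {a : k} (ha : a ≠ 0)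
    (x : A) : Associated (a • x) x :=
  Associated.symm ⟨Units.map (algebraMap k A : k →* A) (Units.mk0 a ha), by
    rw [mul_comm]; exact (Algebra.smul_def _ _).symm⟩

end Evaluation

namespace DoubleDanielewski

open NewCoord

variable {k : Type*} [Field k] {S₁ S₂ : DoubleDanielewski k} {a c u : k} {δ : k[X]}
  {f g : k[X][X]}

theorem polyG_newCoord (hd : S₁.d = S₂.d) (ha : a ≠ 0)
    (h : evalXZ (a • C X : k[X][X]) (c • X + C δ) S₂.P = c ^ S₁.r • S₁.P + C X ^ S₁.d * f) :
    S₂.polyG (X₂ a) (Y₂ ((a ^ S₁.d)⁻¹ * c ^ S₁.r) ((a ^ S₁.d)⁻¹ • f)) (Z₂ c δ) =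
      c ^ S₁.r • S₁.polyG (MvPolynomial.X 0) (MvPolynomial.X 1) (MvPolynomial.X 2) := by
  have hsub (q : MvPolynomial (Fin 3) k) :
      (a • MvPolynomial.X 0) ^ S₁.d * ((a ^ S₁.d)⁻¹ • q) = MvPolynomial.X 0 ^ S₁.d * q := by
    rw [_root_.smul_pow, smul_mul_smul_comm, mul_inv_cancel₀ (pow_ne_zero _ ha), one_smul]
  rw [polyG, polyG, X₂, Y₂, Z₂, ← evalXZ_smul_X_linear, h, ← hd, evalXZ_smul, mul_smul, ← smul_add,
    hsub]
  simp [smul_sub, mul_add]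

theorem tripleIdeal_newCoord (he : S₁.e = S₂.e) (ha : a ≠ 0) (hc : c ≠ 0) (hu : u ≠ 0)
    (ψ : S₂.B ≃ₐ[k] S₁.B) (hx : ψ S₂.x = a • S₁.x)
    (hy : ψ S₂.y = u • S₁.y + evalXZ S₁.x S₁.z g) (hz : ψ S₂.z = c • S₁.z + aeval S₁.x δ) :
    S₂.tripleIdeal (X₂ a) (Y₂ u g) (Z₂ c δ) =
      S₁.tripleIdeal (MvPolynomial.X 0) (MvPolynomial.X 1) (MvPolynomial.X 2) := by
  have hσ := map_tripleIdeal_eq_of_comp_coordHom (σ := (substEquiv δ g ha hc hu).toAlgHom)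
    (substEquiv δ g ha hc hu).surjective he ψ (hx ▸ associated_smul ha S₁.x) (by
      refine MvPolynomial.algHom_ext fun i => ?_
      fin_cases i
      · simp [X₂, hx]
      · simp [Y₂, hy, algHom_evalXZ]
      · simp [Z₂, hz, ← aeval_algHom_apply])
  simpa [map_tripleIdeal] using hσ

theorem nonempty_algEquiv (hd : S₁.d = S₂.d) (he : S₁.e = S₂.e) (ha : a ≠ 0) (hc : c ≠ 0)
    (hP : evalXZ (a • C X : k[X][X]) (c • X + C δ) S₂.P = c ^ S₁.r • S₁.P + C X ^ S₁.d * f)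
    (hI : S₂.tripleIdeal (X₂ a) (Y₂ ((a ^ S₁.d)⁻¹ * c ^ S₁.r) ((a ^ S₁.d)⁻¹ • f)) (Z₂ c δ) =
      S₁.tripleIdeal (MvPolynomial.X 0) (MvPolynomial.X 1) (MvPolynomial.X 2)) :
    Nonempty (S₁.B ≃ₐ[k] S₂.B) := by
  have hu : (a ^ S₁.d)⁻¹ * c ^ S₁.r ≠ 0 :=
    mul_ne_zero (inv_ne_zero (pow_ne_zero _ ha)) (pow_ne_zero _ hc)
  let σ := substEquiv δ ((a ^ S₁.d)⁻¹ • f) ha hc hu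
  refine nonempty_algEquiv_of_coord σ he ?_ ?_ ?_
  · rw [substEquiv_X_zero]
    exact associated_smul ha _
  · have hG := algHom_polyG S₂ σ.toAlgHom (MvPolynomial.X 0) (MvPolynomial.X 1) (MvPolynomial.X 2)
    simp only [AlgEquiv.toAlgHom_apply, σ, substEquiv_X_zero, substEquiv_X_one,
      substEquiv_X_two, polyG_newCoord hd ha hP] at hG
    rw [hG]
    exact associated_smul (pow_ne_zero _ hc) _
  · simpa [map_tripleIdeal, σ] using hI

section RestrictionToZero

theorem mem_tripleIdeal_zero_iff (S : DoubleDanielewski k) {A : Type*} [CommRing A] [Algebra k A]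
    {b z p : A} :
    p ∈ S.tripleIdeal 0 b z ↔ ∃ α β, α * evalXYZ 0 b z S.Q + β * evalXZ 0 z S.P = p := by
  rw [tripleIdeal, polyG, zero_pow S.d_pos.ne', zero_pow S.e_pos.ne', zero_mul, sub_zero,
    Set.pair_comm, Set.insert_comm, Ideal.span_insert_zero, Ideal.mem_span_pair]

theorem tripleIdeal_zero_eq (h : S₂.tripleIdeal (X₂ a) (Y₂ u g) (Z₂ c δ) =
      S₁.tripleIdeal (MvPolynomial.X 0) (MvPolynomial.X 1) (MvPolynomial.X 2)) :
    S₂.tripleIdeal 0 (u • X + C (evalXZ (0 : k[X]) X g)) (c • C X + C (C (δ.eval 0))) =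
      S₁.tripleIdeal (0 : k[X][X]) X (C X) := by
  have hπ := congrArg (Ideal.map (MvPolynomial.aeval ![0, X, C X] :
    MvPolynomial (Fin 3) k →ₐ[k] k[X][X])) h
  rw [map_tripleIdeal, map_tripleIdeal] at hπ
  simpa [X₂, Y₂, Z₂, algHom_evalXZ, ← aeval_algHom_apply, aeval_zero_eq_C, ← evalXZ_C_C] using hπ

theorem exists_evalXYZ_zero_eq (hs : S₁.s = S₂.s) (hu : u ≠ 0)
    (h : S₂.tripleIdeal (X₂ a) (Y₂ u g) (Z₂ c δ) =
      S₁.tripleIdeal (MvPolynomial.X 0) (MvPolynomial.X 1) (MvPolynomial.X 2)) :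
    ∃ h : k[X][X], h.degree < S₁.s ∧
      evalXYZ (0 : k[X][X]) (u • X + C (evalXZ (0 : k[X]) X g))
          (c • C X + C (C (δ.eval 0))) S₂.Q =
        u ^ S₁.s • evalXYZ (0 : k[X][X]) X (C X) S₁.Q + h * C (evalXZ (0 : k[X]) X S₁.P) := by
  have hmem := S₂.evalXYZ_Q_mem_tripleIdeal (0 : k[X][X]) (u • X + C (evalXZ (0 : k[X]) X g))
    (c • C X + C (C (δ.eval 0)))
  rw [tripleIdeal_zero_eq h] at hmem
  obtain ⟨α, β, hαβ⟩ := S₁.mem_tripleIdeal_zero_iff.1 hmem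
  have hz : c • C X + C (C (δ.eval 0)) = (C (c • X + C (δ.eval 0)) : k[X][X]) := by
    rw [map_add, smul_C]
  rw [← map_zero C, evalXZ_C_C, hz, evalXYZ_C_left, evalXYZ_C_left, comp_X] at hαβ
  rw [← map_zero C, hz, evalXYZ_C_left, evalXYZ_C_left, comp_X]
  set q₁ := S₁.Q.map (evalXZHom (0 : k[X]) X).toRingHom
  have hq₁ : q₁.Monic := S₁.Q_monic.map _
  have hq₁d : q₁.natDegree = S₁.s := S₁.Q_monic.natDegree_map _
  have hdeg := degree_comp_linear_sub_lt
    (S₂.Q_monic.map (evalXZHom 0 (c • X + C (δ.eval 0))).toRingHom) hq₁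
    ((S₂.Q_monic.natDegree_map _).trans (hs.symm.trans hq₁d.symm)) hu (evalXZ (0 : k[X]) X g)
  rw [← degree_eq_natDegree hq₁.ne_zero, hq₁d] at hdeg
  obtain ⟨h', hh', hD⟩ := exists_eq_mul_C_of_eq_add (α := α - algebraMap k _ (u ^ S₁.s)) (β := β)
    hq₁ hdeg (by rw [← hαβ, Algebra.smul_def]; ring)
  rw [degree_eq_natDegree hq₁.ne_zero, hq₁d] at hh'
  exact ⟨h', hh', sub_eq_iff_eq_add'.1 hD⟩

end RestrictionToZero

end DoubleDanielewski

theorem DoubleDanielewski.MLCondition.s_pos {k : Type*} [Field k] {S : DoubleDanielewski k}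
    (h : S.MLCondition) : 0 < S.s := by
  rcases h with h | h | h <;> omega

open DoubleDanielewski NewCoord

theorem mainTheorem1_general {k : Type*} [Field k] (S₁ S₂ : DoubleDanielewski k) :
    (1 < S₁.r → 0 < S₁.s → 1 < S₂.r → 0 < S₂.s → ∀ ψ : S₂.B ≃ₐ[k] S₁.B,
      S₁.r = S₂.r ∧ S₁.s = S₂.s ∧
      ∃ (lam gam : k) (δ : k[X]), lam ≠ 0 ∧ gam ≠ 0 ∧
        ψ S₂.x = lam • S₁.x ∧
        ψ S₂.z = gam • S₁.z + aeval S₁.x δ ∧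
        (1 < S₁.s →
          S₁.d = S₂.d ∧ S₁.e = S₂.e ∧
          ∃ f : k[X][X], f.degree < (S₁.r : WithBot ℕ) ∧
          ∃ (nu : k) (g : k[X][X]),
            nu = (lam ^ S₁.d)⁻¹ * gam ^ S₁.r ∧ g = (lam ^ S₁.d)⁻¹ • f ∧
            ψ S₂.y = nu • S₁.y + evalXZ S₁.x S₁.z g ∧
            evalXZ (lam • C X : k[X][X]) (gam • X + C δ) S₂.P =
              gam ^ S₁.r • S₁.P + C X ^ S₁.d * f ∧
            evalXZ (0 : k[X]) (gam • X + C (δ.eval 0)) S₂.P =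
              gam ^ S₁.r • evalXZ (0 : k[X]) X S₁.P ∧
            Algebra.adjoin k {X₂ lam, Y₂ nu g, Z₂ gam δ} = ⊤ ∧
            S₂.polyG (X₂ lam) (Y₂ nu g) (Z₂ gam δ) =
              gam ^ S₁.r • S₁.polyG (MvPolynomial.X 0) (MvPolynomial.X 1) (MvPolynomial.X 2) ∧
            S₂.tripleIdeal (X₂ lam) (Y₂ nu g) (Z₂ gam δ) =
              S₁.tripleIdeal (MvPolynomial.X 0) (MvPolynomial.X 1) (MvPolynomial.X 2) ∧
            ∃ h : k[X][X], h.degree < (S₁.s : WithBot ℕ) ∧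
              evalXYZ (0 : k[X][X]) (nu • X + C (evalXZ (0 : k[X]) X g))
                  (gam • C X + C (C (δ.eval 0))) S₂.Q =
                nu ^ S₁.s • evalXYZ (0 : k[X][X]) X (C X) S₁.Q +
                  h * C (evalXZ (0 : k[X]) X S₁.P))) ∧
    (S₁.d = S₂.d → S₁.e = S₂.e →
      (∃ (lam gam : k) (δ : k[X]) (f : k[X][X]), lam ≠ 0 ∧ gam ≠ 0 ∧
        evalXZ (lam • C X : k[X][X]) (gam • X + C δ) S₂.P =
          gam ^ S₁.r • S₁.P + C X ^ S₁.d * f ∧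
        ∃ (nu : k) (g : k[X][X]),
          nu = (lam ^ S₁.d)⁻¹ * gam ^ S₁.r ∧ g = (lam ^ S₁.d)⁻¹ • f ∧
          S₂.tripleIdeal (X₂ lam) (Y₂ nu g) (Z₂ gam δ) =
            S₁.tripleIdeal (MvPolynomial.X 0) (MvPolynomial.X 1) (MvPolynomial.X 2)) →
      Nonempty (S₁.B ≃ₐ[k] S₂.B)) := by
  refine ⟨fun hr₁ hs₁ hr₂ hs₂ ψ => ?_, ?_⟩
  · have hN := poleOrder_eq hr₁ hs₁ hr₂ hs₂ ψ
    have hr := r_eq_of_poleOrder_eq (by omega) hs₁ (by omega) hs₂ hN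
    obtain ⟨a, ha, hx⟩ := exists_map_x_eq_smul hr₁ hs₁ hr₂ hs₂ ψ
    obtain ⟨c, δ, hc, hz⟩ := exists_map_z_eq hr₁ hs₁ hr₂ hs₂ ha ψ hx
    refine ⟨hr, s_eq_of_poleOrder_eq (by omega) hs₁ hs₂ hr hN, a, c, δ, ha, hc, hx, hz,
      fun hs => ?_⟩
    obtain ⟨hd, he, hs₁₂⟩ := d_e_s_eq_of_poleOrder_eq (by omega) hs hs₂ hr hN
    obtain ⟨f, hf, hy, hP⟩ := exists_map_y_eq (by omega) hs₁ hr hd ha hc ψ.toAlgHom hx hz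
    have hu : (a ^ S₁.d)⁻¹ * c ^ S₁.r ≠ 0 :=
      mul_ne_zero (inv_ne_zero (pow_ne_zero _ ha)) (pow_ne_zero _ hc)
    have hI := tripleIdeal_newCoord he ha hc hu ψ hx hy hz
    exact ⟨hd, he, f, hf, _, _, rfl, rfl, hy, hP, evalXZ_zero_eq hP, adjoin_eq_top _ _ ha hc hu,
      polyG_newCoord hd ha hP, hI, exists_evalXYZ_zero_eq hs₁₂ hu hI⟩
  · rintro hd he ⟨a, c, δ, f, ha, hc, hP, _, _, rfl, rfl, hI⟩
    exact nonempty_algEquiv hd he ha hc hP hI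

end

theorem mainTheorem1 {k : Type*} [Field k] (S₁ S₂ : DoubleDanielewski k)
    (hML₁ : S₁.MLCondition) (hML₂ : S₂.MLCondition) :
    -- the conditions (I) and (II) are necessary
    (1 < S₁.r → 1 < S₂.r → ∀ ψ : S₂.B ≃ₐ[k] S₁.B,
      S₁.r = S₂.r ∧ S₁.s = S₂.s ∧
      ∃ (lam gam : k) (δ : Polynomial k), lam ≠ 0 ∧ gam ≠ 0 ∧
        ψ S₂.x = lam • S₁.x ∧
        ψ S₂.z = gam • S₁.z + Polynomial.aeval S₁.x δ ∧
        (1 < S₁.s →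
          S₁.d = S₂.d ∧ S₁.e = S₂.e ∧
          ∃ f : Polynomial (Polynomial k), f.degree < (S₁.r : WithBot ℕ) ∧
          ∃ (nu : k) (g : Polynomial (Polynomial k)),
            nu = (lam ^ S₁.d)⁻¹ * gam ^ S₁.r ∧ g = (lam ^ S₁.d)⁻¹ • f ∧
            -- (i)
            ψ S₂.y = nu • S₁.y + evalXZ S₁.x S₁.z g ∧
            -- (ii), an identity in `k[X, Z]`
            evalXZ (lam • Polynomial.C Polynomial.X : Polynomial (Polynomial k))
                (gam • Polynomial.X + Polynomial.C δ) S₂.P =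
              gam ^ S₁.r • S₁.P + Polynomial.C Polynomial.X ^ S₁.d * f ∧
            -- its restriction to `X = 0`, an identity in `k[Z]`
            evalXZ (0 : Polynomial k) (gam • Polynomial.X + Polynomial.C (δ.eval 0)) S₂.P =
              gam ^ S₁.r • evalXZ (0 : Polynomial k) Polynomial.X S₁.P ∧
            -- (a)
            Algebra.adjoin k {NewCoord.X₂ lam, NewCoord.Y₂ nu g, NewCoord.Z₂ gam δ} = ⊤ ∧
            -- (b)
            S₂.polyG (NewCoord.X₂ lam) (NewCoord.Y₂ nu g) (NewCoord.Z₂ gam δ) =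
              gam ^ S₁.r • S₁.polyG (MvPolynomial.X 0) (MvPolynomial.X 1) (MvPolynomial.X 2) ∧
            -- (c)
            S₂.tripleIdeal (NewCoord.X₂ lam) (NewCoord.Y₂ nu g) (NewCoord.Z₂ gam δ) =
              S₁.tripleIdeal (MvPolynomial.X 0) (MvPolynomial.X 1) (MvPolynomial.X 2) ∧
            -- the resulting identity at `X = 0`, in `k[Y, Z]` represented as `k[Z][Y]`
            ∃ h : Polynomial (Polynomial k), h.degree < (S₁.s : WithBot ℕ) ∧
              evalXYZ (0 : Polynomial (Polynomial k))
                  (nu • Polynomial.X + Polynomial.C (evalXZ (0 : Polynomial k) Polynomial.X g))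
                  (gam • Polynomial.C Polynomial.X + Polynomial.C (Polynomial.C (δ.eval 0)))
                  S₂.Q =
                nu ^ S₁.s • evalXYZ (0 : Polynomial (Polynomial k)) Polynomial.X
                    (Polynomial.C Polynomial.X) S₁.Q +
                  h * Polynomial.C (evalXZ (0 : Polynomial k) Polynomial.X S₁.P))) ∧
    -- and, when `s > 1`, sufficient
    (S₁.r = S₂.r → S₁.s = S₂.s → 1 < S₁.s → S₁.d = S₂.d → S₁.e = S₂.e →
      (∃ (lam gam : k) (δ : Polynomial k) (f : Polynomial (Polynomial k)),
        lam ≠ 0 ∧ gam ≠ 0 ∧ f.degree < (S₁.r : WithBot ℕ) ∧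
        evalXZ (lam • Polynomial.C Polynomial.X : Polynomial (Polynomial k))
                (gam • Polynomial.X + Polynomial.C δ) S₂.P =
          gam ^ S₁.r • S₁.P + Polynomial.C Polynomial.X ^ S₁.d * f ∧
        ∃ (nu : k) (g : Polynomial (Polynomial k)),
          nu = (lam ^ S₁.d)⁻¹ * gam ^ S₁.r ∧ g = (lam ^ S₁.d)⁻¹ • f ∧
          S₂.tripleIdeal (NewCoord.X₂ lam) (NewCoord.Y₂ nu g) (NewCoord.Z₂ gam δ) =
            S₁.tripleIdeal (MvPolynomial.X 0) (MvPolynomial.X 1) (MvPolynomial.X 2)) →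
      Nonempty (S₁.B ≃ₐ[k] S₂.B)) :=
  ⟨fun hr₁ hr₂ => (mainTheorem1_general S₁ S₂).1 hr₁ hML₁.s_pos hr₂ hML₂.s_pos,
    fun _ _ _ hd he ⟨lam, gam, δ, f, hlam, hgam, _, h⟩ =>
      (mainTheorem1_general S₁ S₂).2 hd he ⟨lam, gam, δ, f, hlam, hgam, h⟩⟩
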